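/- Let $\mathbb{D}$ and $\mathbb{T}$ be the open unit disk and the unit circle in $\mathbb{C}$, let $dA = \pi^{-1}\,dx\,dy$ be normalized area measure on $\mathbb{D}$, and let $m$ be arclength measure on $\mathbb{T}$, normalized by $m(\mathbb{T})=1$. Let $G:[0,1]\to[0,\infty)$ be an increasing (not necessarily strictly) function with $G(0)=0$, and let $w\ge 0$ be a Borel measurable function on $\mathbb{T}$ with $w\in L^1(m)$. Define measures on $\overline{\mathbb{D}}$ by $$d\mu_{\mathbb{D}}(z) = G(1-|z|)\,dA(z), \qquad d\mu_{\mathbb{T}} = w\,dm, \qquad \mu=\mu_{\mathbb{D}}+\mu_{\mathbb{T}}.$$ For $0<t<\infty$ and a finite compactly supported Borel measure $\nu$ on $\mathbb{C}$, let $\mathcal{P}^t(\nu)$ denote the closure in $L^t(\nu)$ of the set of analytic polynomials $p(z)=\sum_{n=0}^N p_n z^n$. The spaces $L^t(\mu_{\mathbb{D}})$ and $L^t(\mu_{\mathbb{T}})$ are regarded as subspaces of $L^t(\mu)$ through extension of functions by zero. **Theorem (Kriete–MacCluer Conjecture 2).** Assume that $$\liminf_{x\to 0^+}\, x\log\bigl(1/G(x)\bigr)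 > 0$$ (with the convention $\log(1/0)=+\infty$) and that $$\int_I \log w\,dm = -\infty$$ for every non-degenerate arc $I$ of $\mathbb{T}$ (with the convention $\log 0=-\infty$). Then, for every finite $t>0$, $$\mathcal{P}^t(\mu) = \mathcal{P}^t(\mu_{\mathbb{D}})\oplus L^t(\mu_{\mathbb{T}}),$$ that is, $\mathcal{P}^t(\mu)$ is the direct sum of its subspaces $\mathcal{P}^t(\mu_{\mathbb{D}})$ and $L^t(\mu_{\mathbb{T}})$ inside $L^t(\mu)$. -/

import Mathlib

open MeasureTheory Filter Topology Set
open scoped ENNReal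

noncomputable section

namespace KrieteMacCluer

/-- The open unit disk. -/
def disk : Set ℂ := Metric.ball 0 1

/-- The unit circle. -/
def circle : Set ℂ := Metric.sphere 0 1

theorem measurableSet_disk : MeasurableSet disk := measurableSet_ball

theorem measurableSet_circle : MeasurableSet circle := Metric.isClosed_sphere.measurableSet

/-- Arclength measure on the unit circle, normalized to total mass one, as a measure on `ℂ`. -/
def arcMeasure : Measure ℂ :=
  (ENNReal.ofReal (2 * Real.pi))⁻¹ •
    (volume.restrict (Ioc (-Real.pi) Real.pi)).map
      (fun θ : ℝ => Complex.exp ((θ : ℂ) * Complex.I))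

/-- The open arc of the unit circle between the angles `a` and `b`. -/
def arc (a b : ℝ) : Set ℂ := (fun θ : ℝ => Complex.exp ((θ : ℂ) * Complex.I)) '' Ioo a b

/-- Area measure on the unit disk, normalized to total mass one. -/
def areaMeasure : Measure ℂ := (ENNReal.ofReal Real.pi)⁻¹ • (volume.restrict disk)

/-- The measure `G(1 - |z|) dA(z)` on the unit disk. -/
def diskMeasure (G : ℝ → ℝ) : Measure ℂ :=
  areaMeasure.withDensity (fun z => ENNReal.ofReal (G (1 - ‖z‖)))

/-- The measure `w dm` on the unit circle. -/
def circleMeasure (w : ℂ → ℝ) : Measure ℂ :=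
  arcMeasure.withDensity (fun z => ENNReal.ofReal (w z))

/-- The measure `G(1 - |z|) dA(z) + w dm` on the closed unit disk. -/
def totalMeasure (G : ℝ → ℝ) (w : ℂ → ℝ) : Measure ℂ := diskMeasure G + circleMeasure w

/-- `liminf_{x → 0+} x log (1 / G(x)) > 0`, computed in the extended reals, where
`log (1 / 0) = +∞`. -/
def ExpDec (G : ℝ → ℝ) : Prop :=
  0 < liminf (fun x : ℝ => (x : EReal) * ENNReal.log (ENNReal.ofReal (G x))⁻¹) (𝓝[>] (0 : ℝ))

/-- The extended-real-valued function `f` has integral `-∞`: its positive part has finite integral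
and its negative part has infinite integral. -/
def IntegralEqBot (f : ℂ → EReal) (ν : Measure ℂ) : Prop :=
  ∫⁻ z, (f z).toENNReal ∂ν < ⊤ ∧ ∫⁻ z, (-f z).toENNReal ∂ν = ⊤

/-- The function `log w`, with `log 0 = -∞`. -/
def logWeight (w : ℂ → ℝ) (z : ℂ) : EReal := ENNReal.log (ENNReal.ofReal (w z))

/-- The closure of the analytic polynomials in `L^p(μ)`. For `p < 1` (where Mathlib has no topology
on `Lp`) closeness is measured by the same functional `(∫ |f|^p dμ)^(1/p)`, which defines the usual
topology of `L^p(μ)`. -/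
def polyClosure (p : ℝ≥0∞) (μ : Measure ℂ) : Submodule ℂ (Lp ℂ p μ) where
  carrier := {f | ∀ ε : ℝ≥0∞, 0 < ε →
    ∃ q : Polynomial ℂ, eLpNorm (fun z => f z - q.eval z) p μ < ε}
  zero_mem' := by
    intro ε hε
    refine ⟨0, ?_⟩
    have h : (fun z => (0 : Lp ℂ p μ) z - (0 : Polynomial ℂ).eval z) =ᵐ[μ] 0 := by
      filter_upwards [Lp.coeFn_zero ℂ p μ] with z hz
      rw [hz]
      simp
    rw [eLpNorm_congr_ae h]
    simpa using hε
  add_mem' := by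
    intro f g hf hg ε hε
    obtain ⟨δ, hδ, H⟩ := exists_Lp_half ℂ μ p hε.ne'
    obtain ⟨q, hq⟩ := hf δ hδ
    obtain ⟨r, hr⟩ := hg δ hδ
    refine ⟨q + r, ?_⟩
    have hm : ∀ (u : Lp ℂ p μ) (s : Polynomial ℂ),
        AEStronglyMeasurable (fun z => u z - s.eval z) μ := fun u s =>
      (Lp.aestronglyMeasurable u).sub s.continuous.aestronglyMeasurable
    have h : (fun z => (f + g : Lp ℂ p μ) z - (q + r).eval z) =ᵐ[μ]
        (fun z => f z - q.eval z) + (fun z => g z - r.eval z) := by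
      filter_upwards [Lp.coeFn_add f g] with z hz
      simp only [hz, Pi.add_apply, Polynomial.eval_add]
      ring
    rw [eLpNorm_congr_ae h]
    exact H _ _ (hm f q) (hm g r) hq.le hr.le
  smul_mem' := by
    intro c f hf ε hε
    have hc : (0 : ℝ≥0∞) < ε / (‖c‖ₑ + 1) :=
      ENNReal.div_pos hε.ne' (by simp)
    obtain ⟨q, hq⟩ := hf _ hc
    refine ⟨Polynomial.C c * q, ?_⟩
    have h : (fun z => (c • f : Lp ℂ p μ) z - (Polynomial.C c * q).eval z) =ᵐ[μ]
        c • (fun z => f z - q.eval z) := by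
      filter_upwards [Lp.coeFn_smul c f] with z hz
      simp only [hz, Pi.smul_apply, Polynomial.eval_mul, Polynomial.eval_C, smul_eq_mul]
      ring
    rw [eLpNorm_congr_ae h, eLpNorm_const_smul]
    have h1 : (‖c‖ₑ + 1) * eLpNorm (fun z => f z - q.eval z) p μ < ε := by
      rw [mul_comm]
      exact (ENNReal.lt_div_iff_mul_lt (by simp) (by simp)).1 hq
    exact lt_of_le_of_lt (by gcongr; exact le_self_add) h1

/-- If `ν` is the restriction of `μ` to the measurable set `S`, then `L^p(ν)` is embedded in
`L^p(μ)` by extending functions by zero outside `S`. -/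
def zeroExt {p : ℝ≥0∞} {μ ν : Measure ℂ} {S : Set ℂ} (hS : MeasurableSet S)
    (h : μ.restrict S = ν) : Lp ℂ p ν →ₗ[ℂ] Lp ℂ p μ where
  toFun f := MemLp.toLp (S.indicator f)
    ((memLp_indicator_iff_restrict hS).2 (h ▸ Lp.memLp f))
  map_add' f g := by
    rw [← MemLp.toLp_add, MemLp.toLp_eq_toLp_iff, ← Set.indicator_add',
      ← ae_eq_restrict_iff_indicator_ae_eq hS, h]
    exact Lp.coeFn_add f g
  map_smul' c f := by
    rw [RingHom.id_apply, ← MemLp.toLp_const_smul, MemLp.toLp_eq_toLp_iff,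
      ← show S.indicator (c • ⇑f) = c • S.indicator ⇑f from Set.indicator_smul S (fun _ => c) f,
      ← ae_eq_restrict_iff_indicator_ae_eq hS, h]
    exact Lp.coeFn_smul c f

theorem diskMeasure_restrict_disk (G : ℝ → ℝ) : (diskMeasure G).restrict disk = diskMeasure G := by
  rw [diskMeasure, restrict_withDensity measurableSet_disk, areaMeasure, Measure.restrict_smul,
    Measure.restrict_restrict measurableSet_disk, inter_self]

theorem arcMeasure_restrict_circle : arcMeasure.restrict circle = arcMeasure := by
  rw [arcMeasure, Measure.restrict_smul, Measure.restrict_map (by fun_prop) measurableSet_circle]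
  have h : (fun θ : ℝ => Complex.exp ((θ : ℂ) * Complex.I)) ⁻¹' circle = univ := by
    ext θ
    simp [circle, Complex.norm_exp_ofReal_mul_I]
  rw [h, Measure.restrict_univ]

theorem circleMeasure_restrict_circle (w : ℂ → ℝ) :
    (circleMeasure w).restrict circle = circleMeasure w := by
  rw [circleMeasure, restrict_withDensity measurableSet_circle, arcMeasure_restrict_circle]

theorem disjoint_disk_circle : Disjoint disk circle := Metric.sphere_disjoint_ball.symm

/-- The measure `G(1 - |z|) dA(z)` is the restriction of the total measure to the open disk. -/
theorem restrict_disk (G : ℝ → ℝ) (w : ℂ → ℝ) :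
    (totalMeasure G w).restrict disk = diskMeasure G := by
  rw [totalMeasure, Measure.restrict_add, diskMeasure_restrict_disk,
    ← circleMeasure_restrict_circle, Measure.restrict_restrict measurableSet_disk,
    disjoint_disk_circle.inter_eq, Measure.restrict_empty, add_zero]

/-- The measure `w dm` is the restriction of the total measure to the unit circle. -/
theorem restrict_circle (G : ℝ → ℝ) (w : ℂ → ℝ) :
    (totalMeasure G w).restrict circle = circleMeasure w := by
  rw [totalMeasure, Measure.restrict_add, circleMeasure_restrict_circle,
    ← diskMeasure_restrict_disk, Measure.restrict_restrict measurableSet_circle,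
    disjoint_disk_circle.symm.inter_eq, Measure.restrict_empty, zero_add]

end KrieteMacCluer

end

/-!
The heart of the matter is that the indicator of the circle is a limit of polynomials in `L^t(μ)`:
there are polynomials close to `1` in `L^t` of the circle part and close to `0` in `L^t` of the
disk part (`exists_poly_approx_indicator`). They have the form `1 - exp Q`, where the polynomial `Q`
is chosen so that

* `Re Q` is very negative on average over the circle against `w`, that is, `∫ exp (Re Q) w dm` is
  small;
* `|Q(z)| ≤ δ / (1 - |z|)` in the disk, with `δ` as small as desired.

The second property makes `exp Q` close to `1` on compact subsets of the disk, and there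
`|1 - exp Q|` grows no faster than `exp (2s / (1 - |z|))` with `s` small, which the decay
`G(x) ≤ C exp (-c / x)` absorbs. To obtain both properties, put mass back: let `Re Q` be close to
`b - N` on the circle, where `N` is a large constant and `b ≥ 0` is a bounded function with
`exp b ≤ max (1, 1 / w)` and with mean `N` over each of many equal arcs. Such a `b` exists because
`log w` has integral `-∞` over each arc (`exists_bounded_le_integral_eq`,
`exists_small_primitive`). Then `∫ exp (b - N) w dm ≤ exp (-N) ∫ (1 + w) dm` is small, while the
primitive of `b - N` along the circle is uniformly small because the arcs are short. This primitive
is the boundary function of `Im V`, where `z V' = Q - Q(0)`, and a gradient estimate for a harmonic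
function bounded by `ε` gives `|V'| ≤ 9 ε / (1 - |z|)` (`norm_deriv_le_of_abs_im_le`,
`norm_eval_le_of_abs_integral_re_le`). Since `b - N` can be replaced by a trigonometric polynomial,
only polynomials `Q` are needed, and no boundary values of analytic functions come up.

The functions `u` on the circle such that the function equal to `u` on the circle and to `0` in the
disk is a limit of polynomials (`PolyApproximable`) are stable under multiplication by polynomials
and, through the backward shift `p ↦ (p - p(0)) / z`, under multiplication by `conj z`. As `1` is
among them, all trigonometric polynomials are, and these are dense in `L^t(w dm)`. So `L^t(w dm)`
lies in the closure, and the rest of the decomposition follows by restricting to the two parts.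
-/

namespace KrieteMacCluer

open Polynomial

/-! ### Trigonometric approximation on the circle -/

theorem exists_poly_add_conj_of_mem_span {f : C(AddCircle (2 * Real.pi), ℂ)}
    (hf : f ∈ Submodule.span ℂ (range (fourier (T := 2 * Real.pi)))) :
    ∃ p q : ℂ[X], ∀ x, f x = p.eval (x.toCircle : ℂ) +
      (starRingEnd ℂ) (q.eval (x.toCircle : ℂ)) := by
  induction hf using Submodule.span_induction with
  | mem f hf =>
    obtain ⟨n, rfl⟩ := hf
    obtain ⟨k, rfl | rfl⟩ := n.eq_nat_or_neg
    · refine ⟨X ^ k, 0, fun x => ?_⟩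
      simp [fourier_apply, AddCircle.toCircle_nsmul]
    · refine ⟨0, X ^ k, fun x => ?_⟩
      rw [fourier_neg]
      simp [fourier_apply, AddCircle.toCircle_nsmul]
  | zero => exact ⟨0, 0, by simp⟩
  | add f g _ _ hf hg =>
    obtain ⟨p, q, h⟩ := hf
    obtain ⟨p', q', h'⟩ := hg
    refine ⟨p + p', q + q', fun x => ?_⟩
    simp only [ContinuousMap.add_apply, h, h', eval_add, map_add]
    ring
  | smul c f _ hf =>
    obtain ⟨p, q, h⟩ := hf
    refine ⟨C c * p, C (starRingEnd ℂ c) * q, fun x => ?_⟩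
    simp only [ContinuousMap.smul_apply, h, eval_mul, eval_C, map_mul, smul_eq_mul,
      Complex.conj_conj]
    ring

/-- A continuous function is uniformly close on the circle to `p + conj q` for some analytic
polynomials `p` and `q`. -/
theorem exists_poly_add_conj_near {g : ℂ → ℂ} (hg : Continuous g) {ε : ℝ} (hε : 0 < ε) :
    ∃ p q : ℂ[X], ∀ z ∈ circle,
      ‖g z - (p.eval z + (starRingEnd ℂ) (q.eval z))‖ ≤ ε := by
  have : Fact (0 < 2 * Real.pi) := ⟨Real.two_pi_pos⟩
  let G : C(AddCircle (2 * Real.pi), ℂ) :=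
    ⟨fun x => g (x.toCircle : ℂ),
      hg.comp (continuous_subtype_val.comp AddCircle.continuous_toCircle)⟩
  have hG : G ∈ (Submodule.span ℂ (range (fourier (T := 2 * Real.pi)))).topologicalClosure := by
    rw [span_fourier_closure_eq_top]
    trivial
  obtain ⟨f, hf, hfG⟩ := Metric.mem_closure_iff.1 hG ε hε
  obtain ⟨p, q, hpq⟩ := exists_poly_add_conj_of_mem_span hf
  refine ⟨p, q, fun z hz => ?_⟩
  obtain ⟨x, hx⟩ := (AddCircle.homeomorphCircle (T := 2 * Real.pi)
    Real.two_pi_pos.ne').surjective ⟨z, mem_sphere_zero_iff_norm.2 (by simpa [circle] using hz)⟩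
  have hxz : (x.toCircle : ℂ) = z := by
    rw [← AddCircle.homeomorphCircle_apply Real.two_pi_pos.ne', hx]
  have := (ContinuousMap.dist_apply_le_dist (f := G) (g := f) x).trans hfG.le
  rw [dist_eq_norm, hpq x, hxz] at this
  simpa [G, hxz] using this

/-! ### Growth of a polynomial with small boundary primitive -/

theorem exists_derivative_eq (p : ℂ[X]) : ∃ q : ℂ[X], derivative q = p := by
  induction p using Polynomial.induction_on' with
  | add p q hp hq =>
    obtain ⟨p', rfl⟩ := hp
    obtain ⟨q', rfl⟩ := hq
    exact ⟨p' + q', derivative_add⟩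
  | monomial n a =>
    refine ⟨monomial (n + 1) (a / (n + 1)), ?_⟩
    rw [derivative_monomial]
    have : (n + 1 : ℂ) ≠ 0 := Nat.cast_add_one_ne_zero n
    simp [this]

theorem norm_le_of_circle {f : ℂ → ℂ} (hf : Differentiable ℂ f) {r C : ℝ} (hr : 0 < r)
    (h : ∀ z, ‖z‖ = r → ‖f z‖ ≤ C) {z : ℂ} (hz : ‖z‖ ≤ r) : ‖f z‖ ≤ C := by
  refine Complex.norm_le_of_forall_mem_frontier_norm_le (U := Metric.ball 0 r)
    Metric.isBounded_ball hf.diffContOnCl (fun z hz => h z ?_) ?_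
  · simpa [frontier_ball _ hr.ne'] using hz
  · simpa [closure_ball _ hr.ne'] using hz

/-- Gradient estimate for a harmonic function bounded by `η`, for the imaginary part of an entire
function. The function `exp (i f / η)` and its reciprocal are bounded by `e` on the disk, by the
maximum principle, so the bound on `f'` follows from the Cauchy estimate for the derivative of
`exp (i f / η)`, with `9 ≥ e ^ 2`. -/
theorem norm_deriv_le_of_abs_im_le {f : ℂ → ℂ} (hf : Differentiable ℂ f) {η : ℝ} (hη : 0 < η)
    (h : ∀ z ∈ circle, |(f z).im| ≤ η) {z : ℂ} (hz : ‖z‖ < 1) :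
    ‖deriv f z‖ ≤ 9 * η / (1 - ‖z‖) := by
  have key : ∀ s : ℂ, s = Complex.I / η ∨ s = -(Complex.I / η) → ∀ z : ℂ, ‖z‖ ≤ 1 →
      ‖Complex.exp (s * f z)‖ ≤ Real.exp 1 := by
    intro s hs z hz
    refine norm_le_of_circle (f := fun z => Complex.exp (s * f z)) (by fun_prop) one_pos
      (fun z hz => ?_) hz
    have h1 := abs_le.1 (h z (by simpa [circle] using hz))
    have h2 : (s * f z).re = -(f z).im / η ∨ (s * f z).re = (f z).im / η := by
      rcases hs with rfl | rfl
      · left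
        rw [div_mul_eq_mul_div, Complex.div_ofReal_re]
        simp
      · right
        rw [neg_mul, div_mul_eq_mul_div, Complex.neg_re, Complex.div_ofReal_re]
        simp [neg_div]
    rw [Complex.norm_exp]
    refine Real.exp_le_exp.2 ?_
    rcases h2 with h2 | h2 <;> rw [h2, div_le_one hη] <;> linarith
  have hr : 0 < 1 - ‖z‖ := by linarith
  have hd : HasDerivAt (fun z => Complex.exp (Complex.I / η * f z))
      (Complex.exp (Complex.I / η * f z) * (Complex.I / η * deriv f z)) z :=
    ((hf z).hasDerivAt.const_mul _).cexp
  have hC : ‖deriv (fun z => Complex.exp (Complex.I / η * f z)) z‖ ≤ Real.exp 1 / (1 - ‖z‖) := by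
    refine Complex.norm_deriv_le_of_forall_mem_sphere_norm_le hr
      (Differentiable.diffContOnCl (by fun_prop)) (fun y hy => key _ (Or.inl rfl) y ?_)
    have : ‖y‖ ≤ ‖y - z‖ + ‖z‖ := by simpa using norm_add_le (y - z) z
    rw [mem_sphere_iff_norm] at hy
    linarith
  have h1 : deriv f z = Complex.exp (-(Complex.I / η) * f z) * (-Complex.I * η) *
      deriv (fun z => Complex.exp (Complex.I / η * f z)) z := by
    have hη' : (η : ℂ) ≠ 0 := by exact_mod_cast hη.ne'
    have h2 : Complex.exp (-(Complex.I / η) * f z) * Complex.exp (Complex.I / η * f z) = 1 := by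
      rw [← Complex.exp_add]
      simp
    have h3 : (-Complex.I * η) * (Complex.I / η) = 1 := by
      field_simp
      simp
    rw [hd.deriv]
    linear_combination (-deriv f z) * h2 -
      (Complex.exp (-(Complex.I / η) * f z) * Complex.exp (Complex.I / η * f z) * deriv f z) * h3
  have he : Real.exp 1 ^ 2 ≤ 9 := by
    have := Real.exp_one_lt_d9
    nlinarith [Real.exp_pos 1]
  rw [h1, norm_mul, norm_mul]
  have h4 : ‖-Complex.I * (η : ℂ)‖ = η := by simp [abs_of_pos hη]
  rw [h4]
  calc _ ≤ Real.exp 1 * η * (Real.exp 1 / (1 - ‖z‖)) := by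
        gcongr
        exact key _ (Or.inr rfl) z hz.le
    _ = Real.exp 1 ^ 2 * η / (1 - ‖z‖) := by ring
    _ ≤ _ := by gcongr

/-- If `Re q` has a small primitive along the unit circle then `q` is small inside the disk. The
primitive is, up to the mean of `Re q`, the imaginary part of a polynomial `v` with
`z v' = q - q(0)`, to which the gradient estimate applies. -/
theorem norm_eval_le_of_abs_integral_re_le {q : ℂ[X]} (hq : (q.coeff 0).im = 0) {ε : ℝ}
    (hε : 0 < ε)
    (h : ∀ x ∈ Icc (-Real.pi) Real.pi,
      |∫ θ in (-Real.pi)..x, (q.eval (Complex.exp ((θ : ℂ) * Complex.I))).re| ≤ ε)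
    {z : ℂ} (hz : ‖z‖ < 1) : ‖q.eval z‖ ≤ 19 * ε / (1 - ‖z‖) := by
  obtain ⟨v, hv⟩ := exists_derivative_eq q.divX
  have hqv : ∀ z, q.eval z = z * (derivative v).eval z + q.coeff 0 := by
    intro z
    conv_lhs => rw [← X_mul_divX_add q, ← hv]
    simp
  set a : ℝ := (q.coeff 0).re with ha
  have ha' : q.coeff 0 = (a : ℂ) := Complex.ext rfl (by simpa using hq)
  set e : ℝ → ℂ := fun θ => Complex.exp ((θ : ℂ) * Complex.I) with he
  have hec : Continuous e := by fun_prop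
  have hd : ∀ θ : ℝ, HasDerivAt (fun θ : ℝ => (v.eval (e θ)).im) ((q.eval (e θ)).re - a) θ := by
    intro θ
    have h1 : HasDerivAt e (e θ * Complex.I) θ := by
      have := ((Complex.ofRealCLM.hasDerivAt (x := θ)).mul_const Complex.I).cexp
      simpa [he] using this
    have h2 : HasDerivAt (fun θ : ℝ => v.eval (e θ))
        ((derivative v).eval (e θ) * (e θ * Complex.I)) θ :=
      (v.hasDerivAt (e θ)).comp θ h1
    have h3 := (Complex.imCLM.hasFDerivAt.comp_hasDerivAt θ h2)
    have h4 : (q.eval (e θ)).re - a =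
        Complex.imCLM ((derivative v).eval (e θ) * (e θ * Complex.I)) := by
      rw [hqv, ha', ← mul_assoc]
      simp [mul_comm]
    rw [h4]
    exact h3
  have hI : ∀ x, (∫ θ in (-Real.pi)..x, (q.eval (e θ)).re) - (x + Real.pi) * a =
      (v.eval (e x)).im - (v.eval (e (-Real.pi))).im := by
    intro x
    have hc : Continuous fun θ => (q.eval (e θ)).re :=
      Complex.continuous_re.comp (q.continuous.comp hec)
    rw [← intervalIntegral.integral_eq_sub_of_hasDerivAt (fun θ _ => hd θ)
      ((hc.sub continuous_const).intervalIntegrable _ _),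
      intervalIntegral.integral_sub (hc.intervalIntegrable _ _) (by simp)]
    simp
  have hper : e Real.pi = e (-Real.pi) := by simp [he, Complex.exp_neg]
  have hpi := Real.pi_gt_three
  have ha2 : |a| * (2 * Real.pi) ≤ ε := by
    have h1 := hI Real.pi
    rw [hper, sub_self, sub_eq_zero] at h1
    have h2 := h Real.pi ⟨by linarith, le_rfl⟩
    rw [h1, abs_mul, abs_of_pos (by linarith)] at h2
    linarith
  have hv2 : ∀ z ∈ circle, |(v.eval z - v.eval (e (-Real.pi))).im| ≤ 2 * ε := by
    intro z hz
    have hz1 : z = e z.arg := by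
      have := Complex.norm_mul_exp_arg_mul_I z
      rw [show ‖z‖ = 1 by simpa [circle] using hz] at this
      simpa [he] using this.symm
    have hz2 := Complex.arg_mem_Ioc z
    have h1 := abs_le.1 (h z.arg ⟨hz2.1.le, hz2.2⟩)
    have h2 : |(z.arg + Real.pi) * a| ≤ ε := by
      rw [abs_mul, abs_of_pos (by linarith [hz2.1]), mul_comm]
      refine le_trans ?_ ha2
      gcongr
      linarith [hz2.2]
    have h2 := abs_le.1 h2
    rw [Complex.sub_im]
    conv_lhs => rw [hz1, ← hI]
    rw [abs_le]
    constructor <;> linarith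
  have h3 := norm_deriv_le_of_abs_im_le (f := fun z => v.eval z - v.eval (e (-Real.pi)))
    (v.differentiable.sub_const _) (by linarith) hv2 hz
  rw [deriv_sub_const, Polynomial.deriv] at h3
  have hr : 0 < 1 - ‖z‖ := by linarith
  have ha3 : |a| ≤ ε / (1 - ‖z‖) := by
    rw [le_div_iff₀ hr]
    nlinarith [abs_nonneg a, norm_nonneg z]
  calc ‖q.eval z‖ ≤ ‖z‖ * ‖(derivative v).eval z‖ + |a| := by
        rw [hqv, ha']
        refine (norm_add_le _ _).trans ?_
        simp
    _ ≤ 1 * (9 * (2 * ε) / (1 - ‖z‖)) + ε / (1 - ‖z‖) := by gcongr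
    _ = _ := by ring

/-! ### Polynomial approximation of exponentials -/

/-- Uniform approximation of `exp q` on the closed disk with small relative error. -/
theorem exists_poly_near_exp (q : ℂ[X]) {δ : ℝ} (hδ : 0 < δ) :
    ∃ p : ℂ[X], ∀ z : ℂ, ‖z‖ ≤ 1 →
      ‖Complex.exp (q.eval z) - p.eval z‖ ≤ δ * ‖Complex.exp (q.eval z)‖ := by
  obtain ⟨R, hR⟩ := (isCompact_closedBall (0 : ℂ) 1).exists_bound_of_continuousOn
    q.continuous.continuousOn
  have hlim := tendstoUniformlyOn_tsum_nat (Real.summable_pow_div_factorial R)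
    (f := fun m z => q.eval z ^ m / (m.factorial : ℂ)) (s := Metric.closedBall 0 1)
    (fun m z hz => by
      rw [norm_div, norm_pow, Complex.norm_natCast]
      gcongr
      exact hR z hz)
  obtain ⟨n, hn⟩ := (Metric.tendstoUniformlyOn_iff.1 hlim (δ * Real.exp (-R))
    (by positivity)).exists
  refine ⟨∑ m ∈ Finset.range n, C (m.factorial : ℂ)⁻¹ * q ^ m, fun z hz => ?_⟩
  have hz' : z ∈ Metric.closedBall (0 : ℂ) 1 := by simpa using hz
  have h := (hn z hz').le
  rw [dist_eq_norm, ← congrFun NormedSpace.exp_eq_tsum_div (q.eval z),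
    ← Complex.exp_eq_exp_ℂ] at h
  have h1 : Real.exp (-R) ≤ ‖Complex.exp (q.eval z)‖ := by
    rw [Complex.norm_exp, Real.exp_le_exp]
    exact neg_le_of_abs_le ((Complex.abs_re_le_norm _).trans (hR z hz'))
  refine le_trans ?_ (h.trans (by gcongr))
  simp [eval_finsetSum, div_eq_inv_mul]

/-! ### Bounded functions with prescribed means below a non-integrable one -/

/-- Below a function of infinite integral there are bounded functions of any prescribed integral:
scale down a truncation. -/
theorem exists_bounded_le_integral_eq {α : Type*} [MeasurableSpace α] {μ : Measure α}
    [IsFiniteMeasure μ] {L : α → ℝ≥0∞} (hL : Measurable L) (hμ : ∫⁻ x, L x ∂μ = ⊤) {A : ℝ}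
    (hA : 0 ≤ A) :
    ∃ (g : α → ℝ) (M : ℝ), Measurable g ∧ (∀ x, 0 ≤ g x) ∧ (∀ x, g x ≤ M) ∧
      (∀ x, ENNReal.ofReal (g x) ≤ L x) ∧ ∫ x, g x ∂μ = A := by
  have hsup : ⨆ n : ℕ, ∫⁻ x, min (L x) n ∂μ = ⊤ := by
    rw [← lintegral_iSup (fun n => hL.min measurable_const)
      (fun m n hmn x => min_le_min le_rfl (by exact_mod_cast hmn)), ← hμ]
    congr 1
    ext x
    change ⨆ n : ℕ, L x ⊓ (n : ℝ≥0∞) = L x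
    rw [← inf_iSup_eq, ENNReal.iSup_natCast, inf_top_eq]
  obtain ⟨n, hn⟩ := lt_iSup_iff.1 (hsup ▸ ENNReal.ofReal_lt_top (r := A))
  set g : α → ℝ := fun x => (min (L x) n).toReal with hg
  have hgm : Measurable g := (hL.min measurable_const).ennreal_toReal
  have hgn : ∀ x, g x ≤ n := fun x =>
    ENNReal.toReal_le_of_le_ofReal n.cast_nonneg (by simp)
  have hgL : ∀ x, ENNReal.ofReal (g x) = min (L x) n := fun x =>
    ENNReal.ofReal_toReal (ne_top_of_le_ne_top (ENNReal.natCast_ne_top n) (min_le_right _ _))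
  have hint : Integrable g μ :=
    Integrable.of_bound hgm.aestronglyMeasurable n (Eventually.of_forall fun x => by
      rw [Real.norm_of_nonneg ENNReal.toReal_nonneg]; exact hgn x)
  have hI : A < ∫ x, g x ∂μ := by
    rw [← ENNReal.ofReal_lt_ofReal_iff_of_nonneg hA, ofReal_integral_eq_lintegral_ofReal hint
      (Eventually.of_forall fun x => ENNReal.toReal_nonneg)]
    simpa [hgL] using hn
  have hI0 : 0 < ∫ x, g x ∂μ := hA.trans_lt hI
  set s : ℝ := A / ∫ x, g x ∂μ with hs
  have hs0 : 0 ≤ s := by positivity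
  have hs1 : s ≤ 1 := (div_le_one hI0).2 hI.le
  have hle : ∀ x, s * g x ≤ g x := fun x => mul_le_of_le_one_left ENNReal.toReal_nonneg hs1
  refine ⟨fun x => s * g x, n, hgm.const_mul s, fun x => mul_nonneg hs0 ENNReal.toReal_nonneg,
    fun x => (hle x).trans (hgn x), fun x => ?_, ?_⟩
  · exact (ENNReal.ofReal_le_ofReal (hle x)).trans ((hgL x).le.trans (min_le_left _ _))
  · rw [integral_const_mul, hs, div_mul_cancel₀ _ hI0.ne']

theorem intervalIntegrable_of_bounded {b : ℝ → ℝ} (hb : Measurable b) {m M : ℝ}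
    (hm : ∀ x, m ≤ b x) (hM : ∀ x, b x ≤ M) (x y : ℝ) : IntervalIntegrable b volume x y := by
  have : IsFiniteMeasure (volume.restrict (uIoc x y)) := by rw [uIoc]; infer_instance
  rw [intervalIntegrable_iff]
  exact Integrable.of_mem_Icc m M hb.aemeasurable (Eventually.of_forall fun x => ⟨hm x, hM x⟩)

/-- Gluing functions below `L` with integral `A` over each of `k` consecutive intervals of
length `h`. -/
theorem exists_grid {L : ℝ → ℝ≥0∞} (hL : Measurable L) {a h A : ℝ} (hh : 0 < h) (hA : 0 ≤ A)
    (k : ℕ) (hk : ∀ j : ℕ, j < k → ∫⁻ x in Ioc (a + j * h) (a + (j + 1) * h), L x = ⊤) :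
    ∃ (b : ℝ → ℝ) (M : ℝ), Measurable b ∧ (∀ x, 0 ≤ b x) ∧ (∀ x, b x ≤ M) ∧
      (∀ x, ENNReal.ofReal (b x) ≤ L x) ∧
      ∀ j : ℕ, j ≤ k → ∫ x in a..(a + j * h), b x = j * A := by
  induction k with
  | zero =>
    refine ⟨0, 0, measurable_const, fun _ => le_rfl, fun _ => le_rfl, by simp, fun j hj => ?_⟩
    simp [Nat.le_zero.1 hj]
  | succ k ih =>
    obtain ⟨b, M, hb, hb0, hbM, hbL, hbI⟩ := ih fun j hj => hk j (hj.trans k.lt_succ_self)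
    obtain ⟨g, M', hg, hg0, hgM, hgL, hgI⟩ :=
      exists_bounded_le_integral_eq hL (hk k k.lt_succ_self) hA
    -- keep the old function to the left of `c`, and use the new one on the last interval
    set c : ℝ := a + k * h with hc
    have hac : a ≤ c := by rw [hc]; linarith [show 0 ≤ k * h by positivity]
    have hcd : c ≤ a + (k + 1) * h := by rw [hc]; linarith
    set f : ℝ → ℝ := fun x => if x ≤ c then b x else g x with hf
    have hfm : Measurable f := Measurable.ite measurableSet_Iic hb hg
    have hf0 : ∀ x, 0 ≤ f x := fun x => by
      simp only [hf]; split_ifs; exacts [hb0 x, hg0 x]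
    have hfM : ∀ x, f x ≤ max M M' := fun x => by
      simp only [hf]
      split_ifs
      exacts [(hbM x).trans (le_max_left _ _), (hgM x).trans (le_max_right _ _)]
    have hfi := intervalIntegrable_of_bounded hfm hf0 hfM
    have hleft : ∀ j : ℕ, j ≤ k → ∫ x in a..(a + j * h), f x = j * A := by
      intro j hj
      have hj' : (j : ℝ) * h ≤ k * h := by gcongr
      have hj0 : 0 ≤ (j : ℝ) * h := by positivity
      rw [← hbI j hj]
      refine intervalIntegral.integral_congr fun x hx => ?_
      rw [uIcc_of_le (by linarith)] at hx
      exact if_pos (by rw [hc]; linarith [hx.2])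
    refine ⟨f, max M M', hfm, hf0, hfM, fun x => ?_, fun j hj => ?_⟩
    · simp only [hf]; split_ifs; exacts [hbL x, hgL x]
    rcases Nat.le_succ_iff.1 hj with hj | rfl
    · exact hleft j hj
    · rw [← intervalIntegral.integral_add_adjacent_intervals (hfi a c) (hfi c _), hleft k le_rfl]
      have : ∫ x in c..(a + (k + 1 : ℕ) * h), f x = A := by
        push_cast
        rw [intervalIntegral.integral_of_le hcd, ← hgI]
        refine setIntegral_congr_fun measurableSet_Ioc fun x hx => ?_
        exact if_neg (not_le.2 hx.1)
      rw [this]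
      push_cast
      ring

/-- If `L` has infinite integral over every interval, there is a bounded function `b` with
`0 ≤ b ≤ L` that oscillates around `N` so that the primitive of `b - N` is uniformly small. The
function has mean `N` over each interval of a fine grid; as its primitive is increasing, it stays
close to the linear function between the points of the grid. -/
theorem exists_small_primitive {L : ℝ → ℝ≥0∞} (hL : Measurable L) {a d : ℝ} (had : a < d)
    (hinf : ∀ x y : ℝ, a ≤ x → x < y → y ≤ d → ∫⁻ s in Ioo x y, L s = ⊤) {N ε : ℝ} (hN : 0 ≤ N)
    (hε : 0 < ε) :
    ∃ (b : ℝ → ℝ) (M : ℝ), Measurable b ∧ (∀ x, 0 ≤ b x) ∧ (∀ x, b x ≤ M) ∧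
      (∀ x, ENNReal.ofReal (b x) ≤ L x) ∧
      ∀ x ∈ Icc a d, |∫ s in a..x, (b s - N)| ≤ ε := by
  have hd0 : 0 < d - a := sub_pos.2 had
  obtain ⟨n, hn⟩ := exists_nat_gt (N * (d - a) / ε)
  have hn0 : (0 : ℝ) < n := lt_of_le_of_lt (by positivity) hn
  set h : ℝ := (d - a) / n with hh
  have hh0 : 0 < h := by positivity
  have hnh : n * h = d - a := by rw [hh]; field_simp
  have hhN : h * N ≤ ε := by
    rw [hh, div_mul_eq_mul_div, div_le_iff₀ hn0]
    rw [div_lt_iff₀ hε] at hn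
    linarith
  obtain ⟨b, M, hb, hb0, hbM, hbL, hbI⟩ := exists_grid (a := a) hL hh0
    (mul_nonneg hh0.le hN) n (fun j hj => by
      rw [setLIntegral_congr Ioo_ae_eq_Ioc.symm]
      have h1 : (0 : ℝ) ≤ j * h := by positivity
      have h2 : ((j : ℝ) + 1) * h ≤ n * h := by
        gcongr
        exact_mod_cast hj
      exact hinf _ _ (by linarith) (by linarith) (by linarith))
  refine ⟨b, M, hb, hb0, hbM, hbL, fun x hx => ?_⟩
  have hbi := intervalIntegrable_of_bounded hb hb0 hbM
  have hmono : ∀ x y, x ≤ y → ∫ s in a..x, b s ≤ ∫ s in a..y, b s := fun x y hxy => by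
    rw [← sub_nonneg, intervalIntegral.integral_interval_sub_left (hbi _ _) (hbi _ _)]
    exact intervalIntegral.integral_nonneg hxy fun s _ => hb0 s
  rw [intervalIntegral.integral_sub (hbi _ _) (by simp)]
  simp only [intervalIntegral.integral_const, smul_eq_mul]
  -- the interval of the grid that contains `x`; the right end point needs the last one
  obtain ⟨j, hj1, hj2, hjn⟩ : ∃ j : ℕ, a + j * h ≤ x ∧ x ≤ a + (j + 1) * h ∧ j < n := by
    rcases eq_or_lt_of_le hx.2 with rfl | hxd
    · have hn1 : 1 ≤ n := Nat.one_le_iff_ne_zero.2 (by rintro rfl; simp at hn0)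
      refine ⟨n - 1, ?_, ?_, by omega⟩ <;> push_cast [hn1] <;> linarith
    · have h0 : 0 ≤ (x - a) / h := div_nonneg (by linarith [hx.1]) hh0.le
      refine ⟨⌊(x - a) / h⌋₊, ?_, ?_, ?_⟩
      · have := Nat.floor_le h0
        rw [le_div_iff₀ hh0] at this
        linarith
      · have := (Nat.lt_floor_add_one ((x - a) / h)).le
        rw [div_le_iff₀ hh0] at this
        linarith
      · rw [Nat.floor_lt h0, div_lt_iff₀ hh0]
        linarith
  have h1 := hmono _ _ hj1
  have h2 := hmono _ _ hj2
  rw [hbI j hjn.le] at h1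
  have h3 := hbI (j + 1) hjn
  push_cast at h3
  rw [h3] at h2
  have h4 := mul_le_mul_of_nonneg_right hj1 hN
  have h5 := mul_le_mul_of_nonneg_right hj2 hN
  rw [abs_le]
  constructor <;> nlinarith

/-- A real number `y` at most `log⁺ (1 / x)` satisfies `e ^ y ≤ max (1, 1 / x)`; the case `x = 0` is
included, where the hypothesis says nothing. -/
theorem exp_mul_le_one_add {x y : ℝ} (hx : 0 ≤ x)
    (h : ENNReal.ofReal y ≤ (-ENNReal.log (ENNReal.ofReal x)).toENNReal) :
    Real.exp y * x ≤ 1 + x := by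
  rcases hx.eq_or_lt with rfl | hx
  · simp
  rw [ENNReal.log_ofReal_of_pos hx, ← EReal.coe_neg, EReal.toENNReal_of_ne_top (EReal.coe_ne_top _),
    EReal.toReal_coe] at h
  rcases le_or_gt y 0 with hy | hy
  · have := Real.exp_le_one_iff.2 hy
    nlinarith
  · have h1 : y ≤ -Real.log x := by
      by_contra! hlt
      rcases le_or_gt (-Real.log x) 0 with h2 | h2
      · rw [ENNReal.ofReal_of_nonpos h2] at h
        exact absurd h (by simpa using hy)
      · exact absurd h (not_le.2 ((ENNReal.ofReal_lt_ofReal_iff hy).2 hlt))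
    have h2 := Real.exp_le_exp.2 h1
    rw [Real.exp_neg, Real.exp_log hx] at h2
    calc Real.exp y * x ≤ x⁻¹ * x := by gcongr
      _ = 1 := inv_mul_cancel₀ hx.ne'
      _ ≤ 1 + x := by linarith

/-! ### The arclength measure in the angular coordinate -/

theorem arg_exp_mul_I_of_mem {θ : ℝ} (hθ : θ ∈ Ioc (-Real.pi) Real.pi) :
    (Complex.exp ((θ : ℂ) * Complex.I)).arg = θ := by
  rw [Complex.arg_exp_mul_I, toIocMod_eq_self]
  rwa [show -Real.pi + 2 * Real.pi = Real.pi by ring]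

theorem exp_arg_mul_I_of_mem_circle {z : ℂ} (hz : z ∈ circle) :
    Complex.exp ((z.arg : ℂ) * Complex.I) = z := by
  have := Complex.norm_mul_exp_arg_mul_I z
  rwa [show ‖z‖ = 1 by simpa [circle] using hz, Complex.ofReal_one, one_mul] at this

theorem lintegral_arcMeasure {f : ℂ → ℝ≥0∞} (hf : Measurable f) :
    ∫⁻ z, f z ∂arcMeasure = (ENNReal.ofReal (2 * Real.pi))⁻¹ *
      ∫⁻ θ in Ioc (-Real.pi) Real.pi, f (Complex.exp ((θ : ℂ) * Complex.I)) := by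
  rw [arcMeasure, lintegral_smul_measure, lintegral_map hf (by fun_prop), smul_eq_mul]

instance isFiniteMeasure_arcMeasure : IsFiniteMeasure arcMeasure := by
  refine ⟨?_⟩
  rw [← lintegral_one, lintegral_arcMeasure measurable_const]
  refine ENNReal.mul_lt_top (by simp [Real.pi_pos]) ?_
  simp

theorem ae_mem_circle_arcMeasure : ∀ᵐ z ∂arcMeasure, z ∈ circle := by
  rw [← arcMeasure_restrict_circle]
  exact ae_restrict_mem measurableSet_circle

theorem ae_mem_circle_circleMeasure (w : ℂ → ℝ) : ∀ᵐ z ∂circleMeasure w, z ∈ circle := by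
  rw [← circleMeasure_restrict_circle]
  exact ae_restrict_mem measurableSet_circle

theorem isFiniteMeasure_circleMeasure {w : ℂ → ℝ} (hw : Integrable w arcMeasure) :
    IsFiniteMeasure (circleMeasure w) :=
  isFiniteMeasure_withDensity_ofReal hw.2

theorem measurable_neg_logWeight {w : ℂ → ℝ} (hw : Measurable w) :
    Measurable fun z => (-logWeight w z).toENNReal :=
  measurable_ereal_toENNReal.comp (continuous_neg.measurable.comp
    hw.ennreal_ofReal.ennreal_log)

theorem lintegral_Ioo_eq_top {f : ℂ → ℝ≥0∞} (hf : Measurable f) {a b : ℝ} (ha : -Real.pi ≤ a)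
    (hb : b ≤ Real.pi) (h : ∫⁻ z in arc a b, f z ∂arcMeasure = ⊤) :
    ∫⁻ θ in Ioo a b, f (Complex.exp ((θ : ℂ) * Complex.I)) = ⊤ := by
  have hsub : Ioo a b ⊆ Ioc (-Real.pi) Real.pi := fun θ hθ =>
    ⟨ha.trans_lt hθ.1, (hθ.2.trans_le hb).le⟩
  have hinj : InjOn (fun θ : ℝ => Complex.exp ((θ : ℂ) * Complex.I)) (Ioc (-Real.pi) Real.pi) :=
    fun θ hθ φ hφ hθφ => by
      rw [← arg_exp_mul_I_of_mem hθ, ← arg_exp_mul_I_of_mem hφ]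
      exact congrArg Complex.arg hθφ
  have harc : MeasurableSet (arc a b) :=
    measurableSet_Ioo.image_of_continuousOn_injOn (Continuous.continuousOn (by fun_prop))
      (hinj.mono hsub)
  rw [arcMeasure, Measure.restrict_smul, lintegral_smul_measure,
    Measure.restrict_map (by fun_prop) harc, lintegral_map hf (by fun_prop),
    Measure.restrict_restrict (harc.preimage (by fun_prop)), smul_eq_mul,
    ENNReal.mul_eq_top] at h
  rcases h with ⟨-, h⟩ | ⟨h, -⟩
  · refine top_unique (h ▸ lintegral_mono_set ?_)
    rintro θ ⟨⟨φ, hφ, hφθ⟩, hθ⟩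
    rwa [← hinj (hsub hφ) hθ hφθ]
  · exact absurd h (ENNReal.inv_ne_top.2 (ENNReal.ofReal_pos.2 Real.two_pi_pos).ne')

/-! ### Polynomials with small exponential against the weight -/

/-- A bounded measurable function is close in `L¹` of a finite measure on the circle to the real
part of a polynomial that obeys nearly the same upper bound. -/
theorem exists_poly_re_near {σ : Measure ℂ} [IsFiniteMeasure σ] (hσ : ∀ᵐ z ∂σ, z ∈ circle)
    {U : ℂ → ℝ} (hU : Measurable U) {m M : ℝ} (hm : ∀ z, m ≤ U z) (hM : ∀ z, U z ≤ M) {η : ℝ}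
    (hη : 0 < η) :
    ∃ q : ℂ[X], (∀ z ∈ circle, (q.eval z).re ≤ M + 1) ∧
      ∫⁻ z, ‖U z - (q.eval z).re‖ₑ ∂σ ≤ ENNReal.ofReal η := by
  have hint : Integrable U σ :=
    Integrable.of_mem_Icc m M hU.aemeasurable (Eventually.of_forall fun z => ⟨hm z, hM z⟩)
  obtain ⟨g, -, hg, hgc, -⟩ := hint.exists_hasCompactSupport_lintegral_sub_le
    (ENNReal.ofReal_pos.2 (half_pos hη)).ne'
  set T := (σ univ).toReal with hT
  have hT0 : 0 ≤ T := ENNReal.toReal_nonneg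
  set ε := min 1 (η / 2 / (T + 1)) with hε
  have hε0 : 0 < ε := by positivity
  have hεT : ε * T ≤ η / 2 := by
    calc ε * T ≤ η / 2 / (T + 1) * (T + 1) := by
          gcongr
          · exact min_le_right _ _
          · linarith
      _ = η / 2 := by field_simp
  obtain ⟨p, q, hpq⟩ := exists_poly_add_conj_near (g := fun z => ((min (g z) M : ℝ) : ℂ))
    (by fun_prop) hε0
  have hre : ∀ z ∈ circle, |min (g z) M - ((p + q).eval z).re| ≤ ε := by
    intro z hz
    refine le_trans (le_of_eq ?_) ((Complex.abs_re_le_norm _).trans (hpq z hz))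
    simp
  refine ⟨p + q, fun z hz => ?_, ?_⟩
  · have h1 := (abs_le.1 (hre z hz)).1
    have h2 := min_le_right (g z) M
    have h3 : ε ≤ 1 := min_le_left _ _
    linarith
  calc ∫⁻ z, ‖U z - ((p + q).eval z).re‖ₑ ∂σ
      ≤ ∫⁻ z, (‖U z - g z‖ₑ + ENNReal.ofReal ε) ∂σ := by
        refine lintegral_mono_ae ?_
        filter_upwards [hσ] with z hz
        rw [← ofReal_norm, ← ofReal_norm, ← ENNReal.ofReal_add (norm_nonneg _)
          hε0.le, Real.norm_eq_abs, Real.norm_eq_abs]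
        refine ENNReal.ofReal_le_ofReal ?_
        have h1 : |U z - min (g z) M| ≤ |U z - g z| := by
          have := hM z
          rcases le_total (g z) M with h | h
          · rw [min_eq_left h]
          · rw [min_eq_right h, abs_of_nonpos (by linarith), abs_of_nonpos (by linarith)]
            linarith
        have h2 := abs_sub_le (U z) (min (g z) M) ((p + q).eval z).re
        have h3 := hre z hz
        linarith
    _ = ∫⁻ z, ‖U z - g z‖ₑ ∂σ + ENNReal.ofReal ε * σ univ := by
        rw [lintegral_add_right _ measurable_const, lintegral_const]
    _ ≤ ENNReal.ofReal (η / 2) + ENNReal.ofReal (η / 2) := by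
        gcongr
        rw [← ENNReal.ofReal_toReal (measure_ne_top σ univ), ← ENNReal.ofReal_mul hε0.le]
        exact ENNReal.ofReal_le_ofReal hεT
    _ = ENNReal.ofReal η := by
        rw [← ENNReal.ofReal_add (by positivity) (by positivity), add_halves]

theorem exp_le_exp_add {r u M : ℝ} (hr : r ≤ M) :
    Real.exp r ≤ Real.exp u + Real.exp M * |u - r| := by
  have h1 := Real.add_one_le_exp (u - r)
  have h2 : Real.exp u = Real.exp r * Real.exp (u - r) := by rw [← Real.exp_add]; ring_nf
  have h3 : Real.exp r * |u - r| ≤ Real.exp M * |u - r| := by gcongr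
  have h4 := neg_abs_le (u - r)
  have h5 := Real.exp_pos r
  nlinarith

/-- The main construction: a polynomial with small growth in the disk whose exponential is small in
`L¹(w dm)`. -/
theorem exists_poly_exp_small {w : ℂ → ℝ} (hw_meas : Measurable w)
    (hw_nonneg : ∀ z ∈ circle, 0 ≤ w z) (hw_int : Integrable w arcMeasure)
    (hw_log : ∀ a b : ℝ, a < b → b ≤ a + 2 * Real.pi →
      IntegralEqBot (logWeight w) (arcMeasure.restrict (arc a b)))
    {δ : ℝ} (hδ : 0 < δ) :
    ∃ q : ℂ[X], (∀ z : ℂ, ‖z‖ < 1 → ‖q.eval z‖ ≤ δ / (1 - ‖z‖)) ∧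
      ∫⁻ z, ENNReal.ofReal (Real.exp (q.eval z).re) ∂circleMeasure w ≤ ENNReal.ofReal δ := by
  have := isFiniteMeasure_circleMeasure hw_int
  have hpi := Real.pi_pos
  set e : ℝ → ℂ := fun θ => Complex.exp ((θ : ℂ) * Complex.I) with he
  have hem : Measurable e := by fun_prop
  set L : ℂ → ℝ≥0∞ := fun z => (-logWeight w z).toENNReal with hL
  have hLm : Measurable L := measurable_neg_logWeight hw_meas
  set T : ℝ := ∫ z, (1 + w z) ∂arcMeasure with hT
  have hTint : Integrable (fun z => 1 + w z) arcMeasure := (integrable_const _).add hw_int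
  have hT0 : 0 ≤ T := integral_nonneg_of_ae (by
    filter_upwards [ae_mem_circle_arcMeasure] with z hz
    have := hw_nonneg z hz
    simp only [Pi.zero_apply]
    linarith)
  obtain ⟨N, hN0, hN⟩ : ∃ N : ℝ, 0 ≤ N ∧ Real.exp (-N) * T ≤ δ / 2 := by
    have h := (Real.tendsto_exp_neg_atTop_nhds_zero.mul_const T)
    rw [zero_mul] at h
    obtain ⟨N, h1, h2⟩ := ((h.eventually (ge_mem_nhds (half_pos hδ))).and
      (eventually_ge_atTop 0)).exists
    exact ⟨N, h2, h1⟩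
  -- `19` is the constant of `norm_eval_le_of_abs_integral_re_le`
  set ε : ℝ := δ / 19 with hε
  have hε0 : 0 < ε := by positivity
  obtain ⟨b, M, hb, hb0, hbM, hbL, hbI⟩ := exists_small_primitive (hLm.comp hem)
    (a := -Real.pi) (d := Real.pi) (by linarith) (fun x y hx hxy hy =>
      lintegral_Ioo_eq_top hLm hx hy (hw_log x y hxy (by linarith)).2) hN0 (half_pos hε0)
  -- the two bounds keep the primitive and the exponential integral under control when `b - N` is
  -- replaced by a polynomial
  set η : ℝ := min (ε / (4 * Real.pi)) (δ / 2 / Real.exp (M - N + 1)) with hη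
  have hη0 : 0 < η := by positivity
  have hη1 : 2 * Real.pi * η ≤ ε / 2 := by
    calc 2 * Real.pi * η ≤ 2 * Real.pi * (ε / (4 * Real.pi)) := by
          gcongr
          exact min_le_left _ _
      _ = ε / 2 := by field_simp; norm_num
  have hη2 : Real.exp (M - N + 1) * η ≤ δ / 2 := by
    calc Real.exp (M - N + 1) * η ≤ Real.exp (M - N + 1) * (δ / 2 / Real.exp (M - N + 1)) := by
          gcongr
          exact min_le_right _ _
      _ = δ / 2 := by field_simp
  set U : ℂ → ℝ := fun z => b z.arg - N with hU
  have hUm : Measurable U := (hb.comp Complex.measurable_arg).sub_const N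
  obtain ⟨q₁, hq₁M, hq₁⟩ := exists_poly_re_near (σ := arcMeasure + circleMeasure w)
    (ae_add_measure_iff.2 ⟨ae_mem_circle_arcMeasure, ae_mem_circle_circleMeasure w⟩) hUm
    (m := -N) (M := M - N) (fun z => by have := hb0 z.arg; simp only [hU]; linarith)
    (fun z => by have := hbM z.arg; simp only [hU]; linarith) hη0
  rw [lintegral_add_measure] at hq₁
  -- an imaginary constant does not affect the real part, and `q` has to be real at the origin
  set q : ℂ[X] := q₁ - C ((q₁.coeff 0).im * Complex.I) with hq
  have hre : ∀ z, (q.eval z).re = (q₁.eval z).re := fun z => by simp [hq]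
  refine ⟨q, fun z hz => ?_, ?_⟩
  · have h19 : 19 * ε = δ := by rw [hε]; ring
    rw [← h19]
    refine norm_eval_le_of_abs_integral_re_le (by simp [hq]) hε0 (fun x hx => ?_) hz
    have hbi := intervalIntegrable_of_bounded hb hb0 hbM (-Real.pi) x
    have hbi' : IntervalIntegrable (fun θ => b θ - N) volume (-Real.pi) x := hbi.sub (by simp)
    have hqi : IntervalIntegrable (fun θ => (q.eval (e θ)).re) volume (-Real.pi) x :=
      (Complex.continuous_re.comp (q.continuous.comp (by fun_prop))).intervalIntegrable _ _
    have h1 : |∫ θ in (-Real.pi)..x, ((q.eval (e θ)).re - (b θ - N))| ≤ ε / 2 := by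
      refine le_trans ?_ hη1
      rw [← ENNReal.ofReal_le_ofReal_iff (by positivity), ← Real.norm_eq_abs,
        ofReal_norm, intervalIntegral.integral_of_le hx.1]
      calc _ ≤ ∫⁻ θ in Ioc (-Real.pi) x, ‖(q.eval (e θ)).re - (b θ - N)‖ₑ :=
            enorm_integral_le_lintegral_enorm _
        _ ≤ ∫⁻ θ in Ioc (-Real.pi) Real.pi, ‖(q.eval (e θ)).re - (b θ - N)‖ₑ :=
            lintegral_mono_set (Ioc_subset_Ioc_right hx.2)
        _ = ∫⁻ θ in Ioc (-Real.pi) Real.pi, ‖U (e θ) - (q₁.eval (e θ)).re‖ₑ := by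
            refine setLIntegral_congr_fun measurableSet_Ioc fun θ hθ => ?_
            simp only [hU, hre, he, arg_exp_mul_I_of_mem hθ]
            exact enorm_sub_rev _ _
        _ = ENNReal.ofReal (2 * Real.pi) * ∫⁻ z, ‖U z - (q₁.eval z).re‖ₑ ∂arcMeasure := by
            rw [lintegral_arcMeasure (f := fun z => ‖U z - (q₁.eval z).re‖ₑ)
              ((hUm.sub (Complex.measurable_re.comp q₁.continuous.measurable)).enorm),
              ← mul_assoc, ENNReal.mul_inv_cancel (ENNReal.ofReal_pos.2 Real.two_pi_pos).ne'
                ENNReal.ofReal_ne_top, one_mul]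
        _ ≤ ENNReal.ofReal (2 * Real.pi) * ENNReal.ofReal η := by
            gcongr
            exact le_self_add.trans hq₁
        _ = ENNReal.ofReal (2 * Real.pi * η) := (ENNReal.ofReal_mul (by positivity)).symm
    have h2 := hbI x hx
    have h3 : ∫ θ in (-Real.pi)..x, (q.eval (e θ)).re =
        (∫ θ in (-Real.pi)..x, ((q.eval (e θ)).re - (b θ - N))) +
          ∫ θ in (-Real.pi)..x, (b θ - N) := by
      rw [intervalIntegral.integral_sub hqi hbi']
      ring
    rw [h3]
    refine (abs_add_le _ _).trans ?_
    linarith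
  -- pointwise `w * exp U = exp (-N) * (w * exp b) ≤ exp (-N) * (1 + w)`
  · have hU_exp : ∫⁻ z, ENNReal.ofReal (Real.exp (U z)) ∂circleMeasure w
        ≤ ENNReal.ofReal (δ / 2) := by
      rw [circleMeasure, lintegral_withDensity_eq_lintegral_mul _ hw_meas.ennreal_ofReal
        hUm.exp.ennreal_ofReal]
      calc _ ≤ ∫⁻ z, ENNReal.ofReal (Real.exp (-N) * (1 + w z)) ∂arcMeasure := by
            refine lintegral_mono_ae ?_
            filter_upwards [ae_mem_circle_arcMeasure] with z hz
            have hwz := hw_nonneg z hz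
            rw [Pi.mul_apply, ← ENNReal.ofReal_mul hwz]
            refine ENNReal.ofReal_le_ofReal ?_
            have h1 := hbL z.arg
            simp only [Function.comp_apply, he, exp_arg_mul_I_of_mem_circle hz] at h1
            have h2 := exp_mul_le_one_add hwz h1
            have h3 : Real.exp (U z) = Real.exp (-N) * Real.exp (b z.arg) := by
              rw [← Real.exp_add]
              simp only [hU]
              ring_nf
            rw [h3]
            nlinarith [Real.exp_pos (-N)]
        _ = ENNReal.ofReal (Real.exp (-N) * T) := by
            rw [← ofReal_integral_eq_lintegral_ofReal (hTint.const_mul _) ?_, integral_const_mul]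
            filter_upwards [ae_mem_circle_arcMeasure] with z hz
            have := hw_nonneg z hz
            simp only [Pi.zero_apply]
            positivity
        _ ≤ _ := ENNReal.ofReal_le_ofReal hN
    calc ∫⁻ z, ENNReal.ofReal (Real.exp (q.eval z).re) ∂circleMeasure w
        ≤ ∫⁻ z, (ENNReal.ofReal (Real.exp (U z)) + ENNReal.ofReal (Real.exp (M - N + 1)) *
            ‖U z - (q₁.eval z).re‖ₑ) ∂circleMeasure w := by
          refine lintegral_mono_ae ?_
          filter_upwards [ae_mem_circle_circleMeasure w] with z hz
          rw [hre, ← ofReal_norm, ← ENNReal.ofReal_mul (by positivity),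
            ← ENNReal.ofReal_add (by positivity) (by positivity)]
          exact ENNReal.ofReal_le_ofReal (exp_le_exp_add (hq₁M z hz))
      _ = ∫⁻ z, ENNReal.ofReal (Real.exp (U z)) ∂circleMeasure w +
            ENNReal.ofReal (Real.exp (M - N + 1)) *
              ∫⁻ z, ‖U z - (q₁.eval z).re‖ₑ ∂circleMeasure w := by
          rw [lintegral_add_left hUm.exp.ennreal_ofReal, lintegral_const_mul' _ _ (by simp)]
      _ ≤ ENNReal.ofReal (δ / 2) + ENNReal.ofReal (Real.exp (M - N + 1)) * ENNReal.ofReal η := by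
          gcongr
          exact le_add_self.trans hq₁
      _ ≤ ENNReal.ofReal (δ / 2) + ENNReal.ofReal (δ / 2) := by
          rw [← ENNReal.ofReal_mul (by positivity)]
          gcongr
      _ = ENNReal.ofReal δ := by
          rw [← ENNReal.ofReal_add (by positivity) (by positivity), add_halves]

/-! ### The measure on the disk -/

/-- The decay of `G` at `0` and monotonicity give an exponential bound on the whole interval. -/
theorem ExpDec.exists_le_exp {G : ℝ → ℝ} (hG : ExpDec G) (hG_mono : MonotoneOn G (Icc 0 1)) :
    ∃ c C : ℝ, 0 < c ∧ 0 ≤ C ∧ ∀ x ∈ Ioc (0 : ℝ) 1, G x ≤ C * Real.exp (-(c / x)) := by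
  obtain ⟨c, hc0, hc⟩ := EReal.lt_iff_exists_real_btwn.1 hG
  have hc0 : 0 < c := by exact_mod_cast hc0
  have hev := eventually_lt_of_lt_liminf hc
  obtain ⟨d, hd0, hd⟩ := mem_nhdsGT_iff_exists_Ioo_subset.1 hev
  have hd0 : 0 < d := hd0
  refine ⟨c, max 1 (|G 1| * Real.exp (c / d)), hc0, by positivity, fun x hx => ?_⟩
  have hx0 : 0 < x := hx.1
  rcases lt_or_ge x d with hxd | hxd
  · have h := hd ⟨hx.1, hxd⟩
    refine le_trans ?_ (le_mul_of_one_le_left (Real.exp_pos _).le (le_max_left _ _))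
    rcases le_or_gt (G x) 0 with hGx | hGx
    · exact hGx.trans (Real.exp_pos _).le
    simp only [mem_ofPred_eq, ENNReal.log_inv, ENNReal.log_ofReal_of_pos hGx] at h
    have h' : c < x * -Real.log (G x) := by exact_mod_cast h
    rw [← Real.log_le_iff_le_exp hGx, le_neg, div_le_iff₀ hx0]
    linarith
  · calc G x ≤ G 1 := hG_mono ⟨hx0.le, hx.2⟩ ⟨zero_le_one, le_rfl⟩ hx.2
      _ ≤ |G 1| * Real.exp (c / d) * Real.exp (-(c / d)) := by
          rw [mul_assoc, ← Real.exp_add]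
          simpa using le_abs_self _
      _ ≤ max 1 (|G 1| * Real.exp (c / d)) * Real.exp (-(c / x)) := by
          gcongr
          exact le_max_right _ _

theorem diskMeasure_le {G : ℝ → ℝ} {H : ℝ → ℝ} (h : ∀ x ∈ Ioc (0 : ℝ) 1, G x ≤ H x) :
    diskMeasure G ≤ areaMeasure.withDensity fun z => ENNReal.ofReal (H (1 - ‖z‖)) := by
  refine withDensity_mono ?_
  have : ∀ᵐ z ∂areaMeasure, z ∈ disk :=
    Measure.ae_smul_measure (ae_restrict_mem measurableSet_disk) _
  filter_upwards [this] with z hz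
  have hz : ‖z‖ < 1 := by simpa [disk] using hz
  exact ENNReal.ofReal_le_ofReal (h _ ⟨by linarith, by linarith [norm_nonneg z]⟩)

theorem ae_mem_disk_diskMeasure (G : ℝ → ℝ) : ∀ᵐ z ∂diskMeasure G, z ∈ disk := by
  rw [← diskMeasure_restrict_disk]
  exact ae_restrict_mem measurableSet_disk

theorem areaMeasure_univ : areaMeasure univ = 1 := by
  simp only [areaMeasure, disk, Measure.smul_apply, Measure.restrict_apply_univ,
    Complex.volume_ball, smul_eq_mul]
  rw [ENNReal.ofReal_one, one_pow, one_mul, ← ENNReal.ofReal_coe_nnreal, NNReal.coe_real_pi]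
  exact ENNReal.inv_mul_cancel (by simp [Real.pi_pos]) (by simp)

/-- Integrals against `G(1 - |z|) dA` are bounded through a measurable majorant of `G`, the total
area being one. -/
theorem lintegral_diskMeasure_le {G : ℝ → ℝ} {H : ℝ → ℝ} (hH : Measurable H)
    (h : ∀ x ∈ Ioc (0 : ℝ) 1, G x ≤ H x) {f : ℂ → ℝ≥0∞} (hf : Measurable f) {B : ℝ≥0∞}
    (hB : ∀ z ∈ disk, ENNReal.ofReal (H (1 - ‖z‖)) * f z ≤ B) :
    ∫⁻ z, f z ∂diskMeasure G ≤ B := by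
  have hae : ∀ᵐ z ∂areaMeasure, z ∈ disk :=
    Measure.ae_smul_measure (ae_restrict_mem measurableSet_disk) _
  calc ∫⁻ z, f z ∂diskMeasure G
      ≤ ∫⁻ z, f z ∂(areaMeasure.withDensity fun z => ENNReal.ofReal (H (1 - ‖z‖))) :=
        lintegral_mono' (diskMeasure_le h) le_rfl
    _ = ∫⁻ z, ENNReal.ofReal (H (1 - ‖z‖)) * f z ∂areaMeasure :=
        lintegral_withDensity_eq_lintegral_mul _
          ((hH.comp (measurable_const.sub measurable_norm)).ennreal_ofReal) hf
    _ ≤ ∫⁻ _, B ∂areaMeasure := by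
        refine lintegral_mono_ae ?_
        filter_upwards [hae] with z hz using hB z hz
    _ = B := by rw [lintegral_const, areaMeasure_univ, mul_one]

theorem isFiniteMeasure_diskMeasure {G : ℝ → ℝ} (hG_mono : MonotoneOn G (Icc 0 1)) :
    IsFiniteMeasure (diskMeasure G) := by
  refine ⟨lt_of_le_of_lt ?_ (ENNReal.ofReal_lt_top (r := G 1))⟩
  rw [← lintegral_one]
  refine lintegral_diskMeasure_le (H := fun _ => G 1) measurable_const (fun x hx => ?_)
    measurable_const fun z _ => by simp
  exact hG_mono ⟨hx.1.le, hx.2⟩ ⟨zero_le_one, le_rfl⟩ hx.2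

/-! ### Approximation of the indicator of the circle -/

theorem norm_exp_sub_one_le_mul_exp (x : ℂ) : ‖Complex.exp x - 1‖ ≤ ‖x‖ * Real.exp ‖x‖ := by
  simpa using Complex.norm_exp_sub_sum_le_norm_mul_exp x 1

/-- The polynomials `1 - exp Q` (up to a small relative error) approximate the indicator of the
circle. Smallness on the disk of radius `1 / 2` is recorded because the measure on the disk may
vanish near the origin and then controls no values there. -/
theorem exists_poly_approx_indicator {G : ℝ → ℝ} (hG_mono : MonotoneOn G (Icc 0 1))
    (hG_dec : ExpDec G) {w : ℂ → ℝ} (hw_meas : Measurable w)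
    (hw_nonneg : ∀ z ∈ circle, 0 ≤ w z) (hw_int : Integrable w arcMeasure)
    (hw_log : ∀ a b : ℝ, a < b → b ≤ a + 2 * Real.pi →
      IntegralEqBot (logWeight w) (arcMeasure.restrict (arc a b)))
    {t : ℝ} (ht : 0 < t) {δ : ℝ} (hδ : 0 < δ) :
    ∃ p : ℂ[X], (∀ z : ℂ, ‖z‖ ≤ 1 / 2 → ‖p.eval z‖ ≤ δ) ∧
      ∫⁻ z, ‖p.eval z‖ₑ ^ t ∂diskMeasure G ≤ ENNReal.ofReal δ ∧
      ∫⁻ z, ‖p.eval z - 1‖ₑ ^ t ∂circleMeasure w ≤ ENNReal.ofReal δ := by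
  obtain ⟨c, C₀, hc, hC₀, hG⟩ := hG_dec.exists_le_exp hG_mono
  obtain ⟨s, hs0, hs1, hs2, hs3, hs4, hs5⟩ : ∃ s : ℝ, 0 < s ∧ s ≤ 1 ∧ 2 * t * s ≤ c ∧
      2 * s * Real.exp 4 ≤ δ ∧ C₀ * (2 * s) ^ t ≤ δ ∧ (2 : ℝ) ^ t * (t * s ^ 2) ≤ δ := by
    have hev : ∀ {f : ℝ → ℝ}, Continuous f → f 0 = 0 → ∀ {d : ℝ}, 0 < d →
        ∀ᶠ s in 𝓝[>] (0 : ℝ), f s ≤ d := fun {f} hf hf0 {d} hd =>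
      ((hf.tendsto' 0 0 hf0).mono_left nhdsWithin_le_nhds).eventually (ge_mem_nhds hd)
    have h4 : Continuous fun s : ℝ => C₀ * (2 * s) ^ t :=
      continuous_const.mul ((continuous_const.mul continuous_id).rpow_const fun _ => Or.inr ht.le)
    obtain ⟨s, h⟩ := ((eventually_mem_nhdsWithin (a := (0 : ℝ)) (s := Ioi 0)).and
      ((hev continuous_id rfl one_pos).and
      ((hev (f := fun s => 2 * t * s) (by fun_prop) (by simp) hc).and
      ((hev (f := fun s => 2 * s * Real.exp 4) (by fun_prop) (by simp) hδ).and
      ((hev h4 (by simp [Real.zero_rpow ht.ne']) hδ).and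
      (hev (f := fun s => (2 : ℝ) ^ t * (t * s ^ 2)) (by fun_prop) (by simp) hδ)))))).exists
    exact ⟨s, h⟩
  -- `Q` is `q / t`, so that `|exp Q| ^ t = exp (Re q)`
  obtain ⟨q, hq, hqw⟩ := exists_poly_exp_small hw_meas hw_nonneg hw_int hw_log
    (δ := t * s ^ 2) (by positivity)
  obtain ⟨p, hp⟩ := exists_poly_near_exp (C ((t : ℂ)⁻¹) * q) hs0
  have hre : ∀ z, ‖Complex.exp ((C ((t : ℂ)⁻¹) * q).eval z)‖ = Real.exp ((q.eval z).re / t) := by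
    intro z
    rw [Complex.norm_exp, eval_mul, eval_C, ← Complex.ofReal_inv, Complex.re_ofReal_mul,
      div_eq_inv_mul]
  have hdisk : ∀ z : ℂ, ‖z‖ < 1 → ‖(1 - p).eval z‖ ≤ 2 * s * Real.exp (2 * s / (1 - ‖z‖)) := by
    intro z hz
    have hr : 0 < 1 - ‖z‖ := by linarith
    -- `|x| ≤ s y` and `y ≤ exp y`: one factor `s` is kept, the rest goes into the exponential
    set y : ℝ := s / (1 - ‖z‖) with hy
    have hy0 : 0 ≤ y := by positivity
    set x : ℂ := (C ((t : ℂ)⁻¹) * q).eval z with hx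
    have hxs : ‖x‖ ≤ s * y := by
      have h1 := hq z hz
      have h2 : ‖x‖ = ‖q.eval z‖ / t := by
        rw [hx, eval_mul, eval_C, norm_mul, norm_inv, Complex.norm_real,
          Real.norm_of_nonneg ht.le, div_eq_inv_mul]
      rw [h2, div_le_iff₀ ht]
      refine h1.trans (le_of_eq ?_)
      rw [hy]
      ring
    have hxy : ‖x‖ ≤ y := hxs.trans (mul_le_of_le_one_left hy0 hs1)
    have hexp : ‖Complex.exp x‖ ≤ Real.exp y :=
      (Complex.norm_exp_le_exp_norm x).trans (Real.exp_le_exp.2 hxy)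
    have h2y : Real.exp (2 * s / (1 - ‖z‖)) = Real.exp y * Real.exp y := by
      rw [← Real.exp_add, hy]
      ring_nf
    have hye : y ≤ Real.exp y := by linarith [Real.add_one_le_exp y]
    have h1e : 1 ≤ Real.exp y := Real.one_le_exp hy0
    calc ‖(1 - p).eval z‖ = ‖(Complex.exp x - p.eval z) - (Complex.exp x - 1)‖ := by
          simp
      _ ≤ ‖Complex.exp x - p.eval z‖ + ‖Complex.exp x - 1‖ := norm_sub_le _ _
      _ ≤ s * ‖Complex.exp x‖ + ‖x‖ * Real.exp ‖x‖ :=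
          add_le_add (hp z hz.le) (norm_exp_sub_one_le_mul_exp x)
      _ ≤ s * (1 * Real.exp y) + s * y * Real.exp y := by
          rw [one_mul]
          gcongr
      _ ≤ s * (Real.exp y * Real.exp y) + s * Real.exp y * Real.exp y := by gcongr
      _ = 2 * s * Real.exp (2 * s / (1 - ‖z‖)) := by rw [h2y]; ring
  refine ⟨1 - p, fun z hz => (hdisk z (by linarith)).trans (le_trans ?_ hs3), ?_, ?_⟩
  · gcongr
    rw [div_le_iff₀ (by linarith)]
    nlinarith
  · refine lintegral_diskMeasure_le (H := fun x => C₀ * Real.exp (-(c / x))) (by fun_prop) hG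
      ((1 - p).continuous.measurable.enorm.pow_const t) fun z hz => ?_
    have hz : ‖z‖ < 1 := by simpa [disk] using hz
    have hr : 0 < 1 - ‖z‖ := by linarith
    rw [← ofReal_norm, ENNReal.ofReal_rpow_of_nonneg (norm_nonneg _) ht.le,
      ← ENNReal.ofReal_mul (by positivity)]
    refine ENNReal.ofReal_le_ofReal (le_trans ?_ hs4)
    calc C₀ * Real.exp (-(c / (1 - ‖z‖))) * ‖(1 - p).eval z‖ ^ t
        ≤ C₀ * Real.exp (-(c / (1 - ‖z‖))) * (2 * s * Real.exp (2 * s / (1 - ‖z‖))) ^ t := by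
          gcongr
          exact hdisk z hz
      _ = C₀ * (2 * s) ^ t * Real.exp ((2 * t * s - c) / (1 - ‖z‖)) := by
          rw [Real.mul_rpow (by positivity) (by positivity), ← Real.exp_mul,
            show (2 * t * s - c) / (1 - ‖z‖) = -(c / (1 - ‖z‖)) + 2 * s / (1 - ‖z‖) * t by ring,
            Real.exp_add]
          ring
      _ ≤ C₀ * (2 * s) ^ t * 1 := by
          gcongr
          exact Real.exp_le_one_iff.2 (div_nonpos_of_nonpos_of_nonneg (by linarith) hr.le)
      _ = _ := mul_one _
  · calc ∫⁻ z, ‖(1 - p).eval z - 1‖ₑ ^ t ∂circleMeasure w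
        ≤ ∫⁻ z, ENNReal.ofReal ((2 : ℝ) ^ t) * ENNReal.ofReal (Real.exp (q.eval z).re)
            ∂circleMeasure w := by
          refine lintegral_mono_ae ?_
          filter_upwards [ae_mem_circle_circleMeasure w] with z hz
          have hz : ‖z‖ = 1 := by simpa [circle] using hz
          rw [← ofReal_norm, ENNReal.ofReal_rpow_of_nonneg (norm_nonneg _) ht.le,
            ← ENNReal.ofReal_mul (by positivity)]
          refine ENNReal.ofReal_le_ofReal ?_
          have h1 := hp z hz.le
          rw [hre] at h1
          have h2 : ‖(1 - p).eval z - 1‖ ≤ 2 * Real.exp ((q.eval z).re / t) := by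
            have h3 : (1 - p).eval z - 1 = (Complex.exp ((C ((t : ℂ)⁻¹) * q).eval z) - p.eval z) -
                Complex.exp ((C ((t : ℂ)⁻¹) * q).eval z) := by simp
            rw [h3]
            refine (norm_sub_le _ _).trans ?_
            rw [hre]
            nlinarith [Real.exp_pos ((q.eval z).re / t)]
          calc _ ≤ (2 * Real.exp ((q.eval z).re / t)) ^ t := by gcongr
            _ = _ := by
              rw [Real.mul_rpow (by positivity) (by positivity), ← Real.exp_mul,
                div_mul_cancel₀ _ ht.ne']
      _ = ENNReal.ofReal ((2 : ℝ) ^ t) *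
            ∫⁻ z, ENNReal.ofReal (Real.exp (q.eval z).re) ∂circleMeasure w :=
          lintegral_const_mul' _ _ (by simp)
      _ ≤ ENNReal.ofReal ((2 : ℝ) ^ t) * ENNReal.ofReal (t * s ^ 2) := by gcongr
      _ ≤ ENNReal.ofReal δ := by
          rw [← ENNReal.ofReal_mul (by positivity)]
          exact ENNReal.ofReal_le_ofReal hs5

/-! ### Functions on the circle approximable together with zero on the disk -/

theorem tendsto_eLpNorm_zero_of_le {μ : Measure ℂ} {T : ℝ≥0∞} {f h g : ℕ → ℂ → ℂ}
    (hf : ∀ n, AEStronglyMeasurable (f n) μ) (hh : ∀ n, AEStronglyMeasurable (h n) μ) (C : ℝ)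
    (hg : ∀ n, ∀ᵐ z ∂μ, ‖g n z‖ ≤ C * (‖f n z‖ + ‖h n z‖))
    (hf0 : Tendsto (fun n => eLpNorm (f n) T μ) atTop (𝓝 0))
    (hh0 : Tendsto (fun n => eLpNorm (h n) T μ) atTop (𝓝 0)) :
    Tendsto (fun n => eLpNorm (g n) T μ) atTop (𝓝 0) := by
  have hlim : Tendsto (fun n => ENNReal.ofReal C * (T.LpAddConst *
      (eLpNorm (f n) T μ + eLpNorm (h n) T μ))) atTop (𝓝 0) := by
    have h1 := ENNReal.Tendsto.const_mul (hf0.add hh0) (Or.inr (ENNReal.LpAddConst_lt_top T).ne)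
    have h2 := ENNReal.Tendsto.const_mul h1 (Or.inr (ENNReal.ofReal_ne_top (r := C)))
    simpa using h2
  refine tendsto_of_tendsto_of_tendsto_of_le_of_le tendsto_const_nhds hlim (fun _ => zero_le)
    fun n => ?_
  have h1 : eLpNorm (g n) T μ ≤ ENNReal.ofReal C * eLpNorm (fun z => ‖f n z‖ + ‖h n z‖) T μ :=
    eLpNorm_le_mul_eLpNorm_of_ae_le_mul (by
      filter_upwards [hg n] with z hz
      rwa [Real.norm_of_nonneg (by positivity)]) T
  refine h1.trans ?_
  gcongr
  have h2 := eLpNorm_add_le' (hf n).norm (hh n).norm T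
  rw [eLpNorm_norm, eLpNorm_norm] at h2
  exact h2

theorem tendsto_eLpNorm_const_zero {μ : Measure ℂ} [IsFiniteMeasure μ] {T : ℝ≥0∞} (hT : T ≠ 0)
    (hT' : T ≠ ⊤) {c : ℕ → ℂ} (hc : Tendsto c atTop (𝓝 0)) :
    Tendsto (fun n => eLpNorm (fun _ : ℂ => c n) T μ) atTop (𝓝 0) := by
  simp_rw [eLpNorm_const' _ hT hT']
  have h : μ univ ^ (1 / T.toReal) ≠ ⊤ :=
    ENNReal.rpow_ne_top_of_nonneg (by positivity) (measure_ne_top μ univ)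
  have h1 : Tendsto (fun n => ‖c n‖ₑ) atTop (𝓝 0) := by
    simpa using hc.enorm
  simpa using ENNReal.Tendsto.mul_const h1 (Or.inr h)

/-- The function equal to `0` for `μ` and to `u` for `ν` is a limit of analytic polynomials in
`L^T`. The measures `μ` and `ν` are to be the two parts of the total measure. In addition the
polynomials tend to `0` uniformly for `|z| ≤ 1 / 2`, at a rate `‖c n‖`; the bound is complex so that
it can serve as a constant function next to the polynomials. -/
def PolyApproximable (T : ℝ≥0∞) (μ ν : Measure ℂ) (u : ℂ → ℂ) : Prop :=
  ∃ (p : ℕ → ℂ[X]) (c : ℕ → ℂ), Tendsto c atTop (𝓝 0) ∧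
    (∀ n z, ‖z‖ ≤ 1 / 2 → ‖(p n).eval z‖ ≤ ‖c n‖) ∧
    Tendsto (fun n => eLpNorm (fun z => (p n).eval z) T μ) atTop (𝓝 0) ∧
    Tendsto (fun n => eLpNorm (fun z => (p n).eval z - u z) T ν) atTop (𝓝 0)

section PolyApproximable

variable {T : ℝ≥0∞} {μ ν : Measure ℂ} {u v : ℂ → ℂ}

theorem aestronglyMeasurable_eval (p : ℂ[X]) (μ : Measure ℂ) :
    AEStronglyMeasurable (fun z => p.eval z) μ :=
  p.continuous.aestronglyMeasurable

theorem PolyApproximable.add (hu : PolyApproximable T μ ν u) (hv : PolyApproximable T μ ν v)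
    (huc : Continuous u) (hvc : Continuous v) : PolyApproximable T μ ν (fun z => u z + v z) := by
  obtain ⟨p, c, hc, hpc, hp, hpu⟩ := hu
  obtain ⟨q, d, hd, hqd, hq, hqv⟩ := hv
  refine ⟨fun n => p n + q n, fun n => ((‖c n‖ + ‖d n‖ : ℝ) : ℂ), ?_, fun n z hz => ?_, ?_, ?_⟩
  · have := (hc.norm.add hd.norm).ofReal
    simpa using this
  · rw [eval_add, Complex.norm_real, Real.norm_of_nonneg (by positivity)]
    exact (norm_add_le _ _).trans (add_le_add (hpc n z hz) (hqd n z hz))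
  · refine tendsto_eLpNorm_zero_of_le (fun n => aestronglyMeasurable_eval _ _)
      (fun n => aestronglyMeasurable_eval _ _) 1 (fun n => Eventually.of_forall fun z => ?_) hp hq
    rw [eval_add, one_mul]
    exact norm_add_le _ _
  · refine tendsto_eLpNorm_zero_of_le
      (fun n => (aestronglyMeasurable_eval _ _).sub huc.aestronglyMeasurable)
      (fun n => (aestronglyMeasurable_eval _ _).sub hvc.aestronglyMeasurable) 1
      (fun n => Eventually.of_forall fun z => ?_) hpu hqv
    rw [eval_add, one_mul, add_sub_add_comm]
    exact norm_add_le _ _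

theorem PolyApproximable.poly_mul (hu : PolyApproximable T μ ν u) (huc : Continuous u) (q : ℂ[X])
    (hμ : ∀ᵐ z ∂μ, ‖z‖ ≤ 1) (hν : ∀ᵐ z ∂ν, ‖z‖ ≤ 1) :
    PolyApproximable T μ ν (fun z => q.eval z * u z) := by
  obtain ⟨p, c, hc, hpc, hp, hpu⟩ := hu
  obtain ⟨R, hR⟩ := (isCompact_closedBall (0 : ℂ) 1).exists_bound_of_continuousOn
    q.continuous.continuousOn
  have hR' : ∀ z : ℂ, ‖z‖ ≤ 1 → ‖q.eval z‖ ≤ R := fun z hz => hR z (by simpa using hz)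
  have hzero : ∀ {σ : Measure ℂ}, Tendsto (fun _ : ℕ => eLpNorm (fun _ : ℂ => (0 : ℂ)) T σ) atTop
      (𝓝 0) := by simp
  refine ⟨fun n => q * p n, fun n => R * c n, by simpa using hc.const_mul (R : ℂ),
    fun n z hz => ?_, ?_, ?_⟩
  · have h1 := hR' z (by linarith)
    rw [eval_mul, norm_mul, norm_mul, Complex.norm_real]
    gcongr
    exacts [h1.trans (le_abs_self R), hpc n z hz]
  · refine tendsto_eLpNorm_zero_of_le (fun n => aestronglyMeasurable_eval _ _)
      (h := fun _ _ => 0) (fun n => aestronglyMeasurable_const) R (fun n => ?_) hp hzero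
    filter_upwards [hμ] with z hz
    rw [eval_mul, norm_mul, norm_zero, add_zero]
    exact mul_le_mul_of_nonneg_right (hR' z hz) (norm_nonneg _)
  · refine tendsto_eLpNorm_zero_of_le
      (fun n => (aestronglyMeasurable_eval _ _).sub huc.aestronglyMeasurable)
      (h := fun _ _ => 0) (fun n => aestronglyMeasurable_const) R (fun n => ?_) hpu hzero
    filter_upwards [hν] with z hz
    rw [eval_mul, ← mul_sub, norm_mul, norm_zero, add_zero]
    exact mul_le_mul_of_nonneg_right (hR' z hz) (norm_nonneg _)

/-- The backward shift `p ↦ (p - p(0)) / z` is controlled by `p` away from the origin, and by the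
maximum principle near the origin. -/
theorem norm_eval_divX_le {p : ℂ[X]} {c : ℝ} (hc : ∀ z : ℂ, ‖z‖ ≤ 1 / 2 → ‖p.eval z‖ ≤ c) (z : ℂ) :
    ‖p.divX.eval z‖ ≤ 4 * (‖p.eval z‖ + c) := by
  have hc0 : 0 ≤ c := (norm_nonneg _).trans (hc 0 (by simp))
  have h0 : ‖p.coeff 0‖ ≤ c := by
    rw [coeff_zero_eq_eval_zero]
    exact hc 0 (by simp)
  have hdiv : ∀ z, ‖z‖ * ‖p.divX.eval z‖ ≤ ‖p.eval z‖ + c := by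
    intro z
    have : z * p.divX.eval z = p.eval z - p.coeff 0 := by
      have h := congrArg (eval z) (divX_mul_X_add p)
      rw [eval_add, eval_mul, eval_X, eval_C] at h
      linear_combination h
    rw [← norm_mul, this]
    exact (norm_sub_le _ _).trans (by gcongr)
  rcases le_or_gt ‖z‖ (1 / 2) with hz | hz
  · have h1 : ‖p.divX.eval z‖ ≤ 4 * c := by
      refine norm_le_of_circle p.divX.differentiable (r := 1 / 2) (by norm_num) (fun z hz => ?_) hz
      have h2 := hdiv z
      have h3 := hc z hz.le
      rw [hz] at h2
      linarith
    linarith [norm_nonneg (p.eval z)]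
  · have h1 := hdiv z
    nlinarith [norm_nonneg (p.eval z), norm_nonneg (p.divX.eval z)]

/-- Stability under multiplication by `conj z`: apply the backward shift
`p ↦ (p - p(0)) / z` to the approximating polynomials. -/
theorem PolyApproximable.conj_mul [IsFiniteMeasure μ] [IsFiniteMeasure ν] (hT : T ≠ 0) (hT' : T ≠ ⊤)
    (hν : ∀ᵐ z ∂ν, z ∈ circle) (hu : PolyApproximable T μ ν u) (huc : Continuous u) :
    PolyApproximable T μ ν (fun z => (starRingEnd ℂ) z * u z) := by
  obtain ⟨p, c, hc, hpc, hp, hpu⟩ := hu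
  refine ⟨fun n => (p n).divX, fun n => 8 * c n, by simpa using hc.const_mul (8 : ℂ),
    fun n z hz => ?_, ?_, ?_⟩
  · have h1 := norm_eval_divX_le (hpc n) z
    have h2 := hpc n z hz
    rw [norm_mul, Complex.norm_ofNat]
    linarith
  · exact tendsto_eLpNorm_zero_of_le (fun n => aestronglyMeasurable_eval _ _)
      (h := fun n _ => c n) (fun n => aestronglyMeasurable_const) 4
      (fun n => Eventually.of_forall fun z => norm_eval_divX_le (hpc n) z) hp
      (tendsto_eLpNorm_const_zero hT hT' hc)
  · refine tendsto_eLpNorm_zero_of_le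
      (fun n => (aestronglyMeasurable_eval _ _).sub huc.aestronglyMeasurable)
      (h := fun n _ => c n) (fun n => aestronglyMeasurable_const) 1 (fun n => ?_) hpu
      (tendsto_eLpNorm_const_zero hT hT' hc)
    filter_upwards [hν] with z hz
    have hz : ‖z‖ = 1 := by simpa [circle] using hz
    have hzz : (starRingEnd ℂ) z * z = 1 := by
      rw [mul_comm, Complex.mul_conj, Complex.normSq_eq_norm_sq, hz]
      simp
    have h0 : ‖(p n).coeff 0‖ ≤ ‖c n‖ := by
      rw [coeff_zero_eq_eval_zero]
      exact hpc n 0 (by simp)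
    have h1 : (p n).divX.eval z - (starRingEnd ℂ) z * u z =
        (starRingEnd ℂ) z * (((p n).eval z - u z) - (p n).coeff 0) := by
      have : (p n).eval z = (p n).divX.eval z * z + (p n).coeff 0 := by
        conv_lhs => rw [← divX_mul_X_add (p n)]
        simp
      rw [this]
      linear_combination (-(p n).divX.eval z) * hzz
    rw [h1, norm_mul, Complex.norm_conj, hz, one_mul, one_mul]
    exact (norm_sub_le _ _).trans (add_le_add le_rfl h0)

theorem PolyApproximable.conj_poly [IsFiniteMeasure μ] [IsFiniteMeasure ν] (hT : T ≠ 0)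
    (hT' : T ≠ ⊤) (hμ : ∀ᵐ z ∂μ, ‖z‖ ≤ 1) (hν : ∀ᵐ z ∂ν, z ∈ circle)
    (h1 : PolyApproximable T μ ν fun _ => 1)
    (q : ℂ[X]) : PolyApproximable T μ ν (fun z => (starRingEnd ℂ) (q.eval z)) := by
  have hν' : ∀ᵐ z ∂ν, ‖z‖ ≤ 1 := by
    filter_upwards [hν] with z hz
    exact (show ‖z‖ = 1 by simpa [circle] using hz).le
  have hpow : ∀ k : ℕ, PolyApproximable T μ ν fun z => (starRingEnd ℂ) z ^ k := by
    intro k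
    induction k with
    | zero => simpa using h1
    | succ k ih =>
      have := ih.conj_mul hT hT' hν (by fun_prop)
      simpa only [pow_succ'] using this
  induction q using Polynomial.induction_on' with
  | add p q hp hq =>
    have := hp.add hq (Complex.continuous_conj.comp p.continuous)
      (Complex.continuous_conj.comp q.continuous)
    simpa only [eval_add, map_add] using this
  | monomial n a =>
    have := (hpow n).poly_mul (by fun_prop) (C (starRingEnd ℂ a)) hμ hν'
    simpa using this

end PolyApproximable

/-- Once the indicator of the circle is approximable, so is every function of `L^T` on the circle,
by density of trigonometric polynomials. -/
theorem exists_poly_near_memLp {T : ℝ≥0∞} {μ ν : Measure ℂ} [IsFiniteMeasure μ]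
    [IsFiniteMeasure ν] (hT : T ≠ 0) (hT' : T ≠ ⊤) (hμ : ∀ᵐ z ∂μ, ‖z‖ ≤ 1)
    (hν : ∀ᵐ z ∂ν, z ∈ circle) (h1 : PolyApproximable T μ ν fun _ => 1) {f : ℂ → ℂ}
    (hf : MemLp f T ν) {ε : ℝ≥0∞} (hε : ε ≠ 0) :
    ∃ p : ℂ[X], eLpNorm (fun z => p.eval z) T μ < ε ∧
      eLpNorm (fun z => f z - p.eval z) T ν < ε := by
  have hν' : ∀ᵐ z ∂ν, ‖z‖ ≤ 1 := by
    filter_upwards [hν] with z hz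
    exact (show ‖z‖ = 1 by simpa [circle] using hz).le
  obtain ⟨ε₁, hε₁, H₁⟩ := exists_Lp_half ℂ ν T hε
  obtain ⟨ε₂, hε₂, H₂⟩ := exists_Lp_half ℂ ν T hε₁.ne'
  obtain ⟨g, -, hfg, hgc, -⟩ := hf.exists_hasCompactSupport_eLpNorm_sub_le hT' hε₁.ne'
  have hconst := tendsto_eLpNorm_const_zero (μ := ν) hT hT'
    (c := fun n : ℕ => (((n : ℝ) + 1)⁻¹ : ℝ)) (by
      have := (tendsto_one_div_add_atTop_nhds_zero_nat (𝕜 := ℝ)).ofReal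
      simpa only [one_div, Complex.ofReal_zero] using this)
  obtain ⟨n, hn⟩ := (hconst.eventually (ge_mem_nhds hε₂)).exists
  obtain ⟨a, b, hab⟩ := exists_poly_add_conj_near hgc (ε := ((n : ℝ) + 1)⁻¹) (by positivity)
  have hgab : eLpNorm (fun z => g z - (a.eval z + (starRingEnd ℂ) (b.eval z))) T ν ≤ ε₂ := by
    refine le_trans (eLpNorm_mono_ae ?_) hn
    filter_upwards [hν] with z hz
    refine (hab z hz).trans (le_of_eq ?_)
    rw [Complex.norm_real, Real.norm_of_nonneg (by positivity)]
  have hbc : Continuous fun z => (starRingEnd ℂ) (b.eval z) :=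
    Complex.continuous_conj.comp b.continuous
  have hatt : PolyApproximable T μ ν fun z => a.eval z + (starRingEnd ℂ) (b.eval z) := by
    have := h1.poly_mul continuous_const a hμ hν'
    simp only [mul_one] at this
    exact this.add (h1.conj_poly hT hT' hμ hν b) a.continuous hbc
  obtain ⟨p, -, -, -, hp, hpab⟩ := hatt
  obtain ⟨m, hm1, hm2⟩ := ((hp.eventually (gt_mem_nhds (pos_iff_ne_zero.2 hε))).and
    (hpab.eventually (ge_mem_nhds hε₂))).exists
  refine ⟨p m, hm1, ?_⟩
  have habc : Continuous fun z => a.eval z + (starRingEnd ℂ) (b.eval z) := a.continuous.add hbc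
  have h2 : eLpNorm (fun z => g z - (p m).eval z) T ν < ε₁ := by
    have := H₂ (fun z => g z - (a.eval z + (starRingEnd ℂ) (b.eval z)))
      (fun z => (a.eval z + (starRingEnd ℂ) (b.eval z)) - (p m).eval z)
      (hgc.sub habc).aestronglyMeasurable (habc.sub (p m).continuous).aestronglyMeasurable hgab
      (by rwa [← eLpNorm_neg, show (-fun z => (a.eval z + (starRingEnd ℂ) (b.eval z)) -
        (p m).eval z) = fun z => (p m).eval z - (a.eval z + (starRingEnd ℂ) (b.eval z)) from
          by ext z; simp])
    simpa [Pi.add_def] using this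
  have := H₁ (f - g) (fun z => g z - (p m).eval z) (hf.1.sub hgc.aestronglyMeasurable)
    (hgc.sub (p m).continuous).aestronglyMeasurable hfg h2.le
  simpa [Pi.add_def] using this

/-! ### The two parts of the total measure -/

theorem ae_totalMeasure {G : ℝ → ℝ} {w : ℂ → ℝ} {P : ℂ → Prop}
    (hd : ∀ᵐ z ∂diskMeasure G, P z) (hc : ∀ᵐ z ∂circleMeasure w, P z) :
    ∀ᵐ z ∂totalMeasure G w, P z :=
  ae_add_measure_iff.2 ⟨hd, hc⟩

theorem eLpNorm_totalMeasure_le {G : ℝ → ℝ} {w : ℂ → ℝ} {T : ℝ≥0∞} {f : ℂ → ℂ}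
    (hf : AEStronglyMeasurable f (totalMeasure G w)) :
    eLpNorm f T (totalMeasure G w) ≤
      T.LpAddConst * (eLpNorm f T (diskMeasure G) + eLpNorm f T (circleMeasure w)) := by
  have h : f =ᵐ[totalMeasure G w] disk.indicator f + circle.indicator f := by
    refine ae_totalMeasure ?_ ?_
    · filter_upwards [ae_mem_disk_diskMeasure G] with z hz
      simp [hz, disjoint_disk_circle.notMem_of_mem_left hz]
    · filter_upwards [ae_mem_circle_circleMeasure w] with z hz
      simp [hz, disjoint_disk_circle.notMem_of_mem_right hz]
  rw [eLpNorm_congr_ae h]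
  refine (eLpNorm_add_le' (hf.indicator measurableSet_disk)
    (hf.indicator measurableSet_circle) T).trans ?_
  rw [eLpNorm_indicator_eq_eLpNorm_restrict measurableSet_disk, restrict_disk,
    eLpNorm_indicator_eq_eLpNorm_restrict measurableSet_circle, restrict_circle]

theorem mem_polyClosure_of_forall {G : ℝ → ℝ} {w : ℂ → ℝ} {T : ℝ≥0∞}
    {f : Lp ℂ T (totalMeasure G w)}
    (h : ∀ ε : ℝ≥0∞, ε ≠ 0 → ∃ p : ℂ[X], eLpNorm (fun z => f z - p.eval z) T (diskMeasure G) < ε ∧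
      eLpNorm (fun z => f z - p.eval z) T (circleMeasure w) < ε) :
    f ∈ polyClosure T (totalMeasure G w) := by
  intro ε hε
  obtain ⟨δ, hδ, hδε⟩ : ∃ δ : ℝ≥0∞, δ ≠ 0 ∧ T.LpAddConst * (δ + δ) < ε := by
    have hlim : Tendsto (fun n : ℕ => T.LpAddConst * ((n : ℝ≥0∞)⁻¹ + (n : ℝ≥0∞)⁻¹)) atTop
        (𝓝 0) := by
      have := ENNReal.Tendsto.const_mul
        (ENNReal.tendsto_inv_nat_nhds_zero.add ENNReal.tendsto_inv_nat_nhds_zero)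
        (Or.inr (ENNReal.LpAddConst_lt_top T).ne)
      simpa using this
    obtain ⟨n, hn⟩ := (hlim.eventually (gt_mem_nhds hε)).exists
    exact ⟨(n : ℝ≥0∞)⁻¹, by simp, hn⟩
  obtain ⟨p, hp1, hp2⟩ := h δ hδ
  refine ⟨p, lt_of_le_of_lt (eLpNorm_totalMeasure_le
    ((Lp.aestronglyMeasurable f).sub (aestronglyMeasurable_eval p _))) (lt_of_le_of_lt ?_ hδε)⟩
  gcongr

theorem zeroExt_ae_eq {p : ℝ≥0∞} {μ ν : Measure ℂ} {S : Set ℂ} (hS : MeasurableSet S)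
    (h : μ.restrict S = ν) (f : Lp ℂ p ν) : zeroExt hS h f =ᵐ[μ] S.indicator f := by
  have hf : MemLp (S.indicator f) p μ :=
    (memLp_indicator_iff_restrict hS).2 (by rw [h]; exact Lp.memLp f)
  have : zeroExt hS h f = hf.toLp := rfl
  rw [this]
  exact hf.coeFn_toLp

theorem diskMeasure_le_totalMeasure (G : ℝ → ℝ) (w : ℂ → ℝ) :
    diskMeasure G ≤ totalMeasure G w := Measure.le_add_right le_rfl

theorem circleMeasure_le_totalMeasure (G : ℝ → ℝ) (w : ℂ → ℝ) :
    circleMeasure w ≤ totalMeasure G w := Measure.le_add_left le_rfl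

theorem disjoint_range_zeroExt (T : ℝ≥0∞) (G : ℝ → ℝ) (w : ℂ → ℝ) :
    Disjoint
      (LinearMap.range (zeroExt (p := T) measurableSet_disk (restrict_disk G w)))
      (LinearMap.range (zeroExt (p := T) measurableSet_circle (restrict_circle G w))) := by
  rw [Submodule.disjoint_def]
  rintro _ ⟨f, rfl⟩ ⟨g, hg⟩
  have h1 := zeroExt_ae_eq measurableSet_disk (restrict_disk G w) f
  have h2 := zeroExt_ae_eq measurableSet_circle (restrict_circle G w) g
  rw [hg] at h2
  rw [Lp.eq_zero_iff_ae_eq_zero]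
  filter_upwards [h1, h2] with z hz1 hz2
  by_cases hz : z ∈ disk
  · rw [hz2, indicator_of_notMem (disjoint_disk_circle.notMem_of_mem_left hz)]
    rfl
  · rw [hz1, indicator_of_notMem hz]
    rfl

theorem polyClosure_le_sup (T : ℝ≥0∞) (G : ℝ → ℝ) (w : ℂ → ℝ) :
    polyClosure T (totalMeasure G w) ≤
      (polyClosure T (diskMeasure G)).map (zeroExt measurableSet_disk (restrict_disk G w)) ⊔
        LinearMap.range (zeroExt (p := T) measurableSet_circle (restrict_circle G w)) := by
  intro f hf
  have hfd : MemLp f T (diskMeasure G) :=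
    (Lp.memLp f).mono_measure (diskMeasure_le_totalMeasure G w)
  have hfc : MemLp f T (circleMeasure w) :=
    (Lp.memLp f).mono_measure (circleMeasure_le_totalMeasure G w)
  refine Submodule.mem_sup.2 ⟨_, ⟨hfd.toLp, fun ε hε => ?_, rfl⟩, _, ⟨hfc.toLp, rfl⟩, ?_⟩
  · obtain ⟨q, hq⟩ := hf ε hε
    refine ⟨q, lt_of_le_of_lt ?_ hq⟩
    refine le_trans (le_of_eq (eLpNorm_congr_ae ?_))
      (eLpNorm_mono_measure _ (diskMeasure_le_totalMeasure G w))
    filter_upwards [hfd.coeFn_toLp] with z hz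
    rw [hz]
  · refine Lp.ext ?_
    have h1 := zeroExt_ae_eq measurableSet_disk (restrict_disk G w) hfd.toLp
    have h2 := zeroExt_ae_eq measurableSet_circle (restrict_circle G w) hfc.toLp
    refine (Lp.coeFn_add _ _).trans ((h1.add h2).trans ?_)
    refine ae_totalMeasure ?_ ?_
    · filter_upwards [ae_mem_disk_diskMeasure G, hfd.coeFn_toLp] with z hz hz'
      simp [hz, disjoint_disk_circle.notMem_of_mem_left hz, hz']
    · filter_upwards [ae_mem_circle_circleMeasure w, hfc.coeFn_toLp] with z hz hz'
      simp [hz, disjoint_disk_circle.notMem_of_mem_right hz, hz']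

theorem sup_le_polyClosure {T : ℝ≥0∞} (hT : T ≠ 0) (hT' : T ≠ ⊤) {G : ℝ → ℝ} {w : ℂ → ℝ}
    [IsFiniteMeasure (diskMeasure G)] [IsFiniteMeasure (circleMeasure w)]
    (h1 : PolyApproximable T (diskMeasure G) (circleMeasure w) fun _ => 1) :
    (polyClosure T (diskMeasure G)).map (zeroExt measurableSet_disk (restrict_disk G w)) ⊔
        LinearMap.range (zeroExt (p := T) measurableSet_circle (restrict_circle G w)) ≤
      polyClosure T (totalMeasure G w) := by
  have hμ : ∀ᵐ z ∂diskMeasure G, ‖z‖ ≤ 1 := by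
    filter_upwards [ae_mem_disk_diskMeasure G] with z hz
    exact (show ‖z‖ < 1 by simpa [disk] using hz).le
  have hν := ae_mem_circle_circleMeasure w
  refine sup_le ?_ ?_
  · rintro _ ⟨f, hf, rfl⟩
    have h2 := zeroExt_ae_eq measurableSet_disk (restrict_disk G w) f
    refine mem_polyClosure_of_forall fun ε hε => ?_
    obtain ⟨δ, hδ, H⟩ := exists_Lp_half ℂ (diskMeasure G) T hε
    obtain ⟨q, hq⟩ := hf δ hδ
    have hqL : MemLp (fun z => q.eval z) T (circleMeasure w) := by
      obtain ⟨R, hR⟩ := (isCompact_sphere (0 : ℂ) 1).exists_bound_of_continuousOn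
        q.continuous.continuousOn
      refine MemLp.of_bound (aestronglyMeasurable_eval q _) R ?_
      filter_upwards [hν] with z hz using hR z hz
    obtain ⟨p, hp1, hp2⟩ := exists_poly_near_memLp hT hT' hμ hν h1 hqL
      (lt_min hδ (pos_iff_ne_zero.2 hε)).ne'
    refine ⟨q - p, ?_, ?_⟩
    · have h3 := H (fun z => f z - q.eval z) (fun z => p.eval z)
        ((Lp.aestronglyMeasurable f).sub (aestronglyMeasurable_eval q _))
        (aestronglyMeasurable_eval p _) hq.le (hp1.trans_le (min_le_left _ _)).le
      refine lt_of_le_of_lt (le_of_eq (eLpNorm_congr_ae ?_)) h3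
      filter_upwards [(diskMeasure_le_totalMeasure G w).absolutelyContinuous.ae_le h2,
        ae_mem_disk_diskMeasure G] with z hz hzd
      rw [hz, indicator_of_mem hzd, Pi.add_apply, eval_sub]
      ring
    · refine lt_of_le_of_lt (le_of_eq ?_) (hp2.trans_le (min_le_right _ _))
      rw [← eLpNorm_neg]
      refine eLpNorm_congr_ae ?_
      filter_upwards [(circleMeasure_le_totalMeasure G w).absolutelyContinuous.ae_le h2, hν]
        with z hz hzc
      rw [Pi.neg_apply, hz, indicator_of_notMem (disjoint_disk_circle.notMem_of_mem_right hzc),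
        eval_sub]
      ring
  · rintro _ ⟨f, rfl⟩
    have h2 := zeroExt_ae_eq measurableSet_circle (restrict_circle G w) f
    refine mem_polyClosure_of_forall fun ε hε => ?_
    obtain ⟨p, hp1, hp2⟩ := exists_poly_near_memLp hT hT' hμ hν h1 (Lp.memLp f) hε
    refine ⟨p, ?_, ?_⟩
    · refine lt_of_le_of_lt (le_of_eq ?_) hp1
      rw [← eLpNorm_neg]
      refine eLpNorm_congr_ae ?_
      filter_upwards [(diskMeasure_le_totalMeasure G w).absolutelyContinuous.ae_le h2,
        ae_mem_disk_diskMeasure G] with z hz hzd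
      rw [Pi.neg_apply, hz, indicator_of_notMem (disjoint_disk_circle.notMem_of_mem_left hzd)]
      ring
    · refine lt_of_le_of_lt (le_of_eq (eLpNorm_congr_ae ?_)) hp2
      filter_upwards [(circleMeasure_le_totalMeasure G w).absolutelyContinuous.ae_le h2, hν]
        with z hz hzc
      rw [hz, indicator_of_mem hzc]

theorem polyApproximable_one {G : ℝ → ℝ} (hG_mono : MonotoneOn G (Icc 0 1))
    (hG_dec : ExpDec G) {w : ℂ → ℝ} (hw_meas : Measurable w)
    (hw_nonneg : ∀ z ∈ circle, 0 ≤ w z) (hw_int : Integrable w arcMeasure)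
    (hw_log : ∀ a b : ℝ, a < b → b ≤ a + 2 * Real.pi →
      IntegralEqBot (logWeight w) (arcMeasure.restrict (arc a b)))
    {t : ℝ} (ht : 0 < t) :
    PolyApproximable (ENNReal.ofReal t) (diskMeasure G) (circleMeasure w) fun _ => 1 := by
  choose p hp0 hpd hpc using fun n : ℕ => exists_poly_approx_indicator hG_mono hG_dec hw_meas
    hw_nonneg hw_int hw_log ht (Nat.one_div_pos_of_nat (α := ℝ) (n := n))
  have hlim := tendsto_one_div_add_atTop_nhds_zero_nat (𝕜 := ℝ)
  have hT : (ENNReal.ofReal t).toReal = t := ENNReal.toReal_ofReal ht.le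
  have key : ∀ {σ : Measure ℂ} {f : ℕ → ℂ → ℂ},
      (∀ n : ℕ, ∫⁻ z, ‖f n z‖ₑ ^ t ∂σ ≤ ENNReal.ofReal (1 / ((n : ℝ) + 1))) →
      Tendsto (fun n => eLpNorm (f n) (ENNReal.ofReal t) σ) atTop (𝓝 0) := by
    intro σ f hf
    have h1 : Tendsto (fun n : ℕ => ENNReal.ofReal (1 / ((n : ℝ) + 1)) ^ (1 / t)) atTop (𝓝 0) := by
      have := (ENNReal.tendsto_ofReal hlim).ennrpow_const (1 / t)
      rwa [ENNReal.ofReal_zero, ENNReal.zero_rpow_of_pos (by positivity)] at this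
    refine tendsto_of_tendsto_of_tendsto_of_le_of_le tendsto_const_nhds h1 (fun _ => zero_le)
      fun n => ?_
    simp only
    rw [eLpNorm_eq_lintegral_rpow_enorm_toReal (ENNReal.ofReal_pos.2 ht).ne'
      ENNReal.ofReal_ne_top, hT]
    exact ENNReal.rpow_le_rpow (hf n) (by positivity)
  refine ⟨p, fun n => ((1 / ((n : ℝ) + 1) : ℝ) : ℂ), by simpa using hlim.ofReal,
    fun n z hz => ?_, key hpd, key hpc⟩
  rw [Complex.norm_real, Real.norm_of_nonneg (by positivity)]
  exact hp0 n z hz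

end KrieteMacCluer

open KrieteMacCluer in
theorem mainTheorem2 (G : ℝ → ℝ) (hG_mono : MonotoneOn G (Icc 0 1)) (hG_zero : G 0 = 0)
    (hG_dec : ExpDec G)
    (w : ℂ → ℝ) (hw_meas : Measurable w) (hw_nonneg : ∀ z ∈ circle, 0 ≤ w z)
    (hw_int : Integrable w arcMeasure)
    (hw_log : ∀ a b : ℝ, a < b → b ≤ a + 2 * Real.pi →
      IntegralEqBot (logWeight w) (arcMeasure.restrict (arc a b)))
    (t : ℝ) (ht : 0 < t) :
    polyClosure (ENNReal.ofReal t) (totalMeasure G w) =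
        (polyClosure (ENNReal.ofReal t) (diskMeasure G)).map
            (zeroExt measurableSet_disk (restrict_disk G w)) ⊔
          LinearMap.range (zeroExt (p := ENNReal.ofReal t)
            measurableSet_circle (restrict_circle G w)) ∧
      Disjoint
        ((polyClosure (ENNReal.ofReal t) (diskMeasure G)).map
            (zeroExt measurableSet_disk (restrict_disk G w)))
        (LinearMap.range (zeroExt (p := ENNReal.ofReal t)
            measurableSet_circle (restrict_circle G w))) := by
  have := isFiniteMeasure_diskMeasure hG_mono
  have := isFiniteMeasure_circleMeasure hw_int
  exact ⟨le_antisymm (polyClosure_le_sup _ G w)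
    (sup_le_polyClosure (ENNReal.ofReal_pos.2 ht).ne' ENNReal.ofReal_ne_top
      (polyApproximable_one hG_mono hG_dec hw_meas hw_nonneg hw_int hw_log ht)),
    (disjoint_range_zeroExt _ G w).mono_left LinearMap.map_le_range⟩
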